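/- Let $(\Omega,\mathcal H,\mathbb P)$ be an abstract Wiener space: $\Omega$ is a separable real Banach space, $\mathbb P$ is a centred Gaussian probability measure with full support on $\Omega$, and $\mathcal H\subset\Omega$ is the associated Cameron–Martin space. Let $\mathcal F$ be the $\mathbb P$-completion of the Borel $\sigma$-algebra of $\Omega$, and let $W=\{W(h):h\in\mathcal H\}$ be the associated isonormal Gaussian process on $(\Omega,\mathcal F,\mathbb P)$. A random variable $F:\Omega\to\mathbb R$ is called locally $\mathcal H$-differentiable if there is a random variable $q$ with values in $[0,\infty]$ and $q>0$ almost surely such that, for every $\omega\in\Omega$, the map $h\mapsto F(\omega+h)$ is continuously Fréchet differentiable on $\{h\in\mathcal H:\|h\|_{\mathcal H}<q(\omega)\}$. The set of these random variables is denoted $\mathcal C^1_{\mathcal H\text{-}\mathrm{loc}}$. A random variable is called smooth if it is of the form $F=f(W(h_1),\dots,W(h_n))$ with $h_1,\dots,h_n\in\mathcal H$ and $f\in C^\infty(\mathbb R^n)$ such that $f$ and all its partial derivatives have at most polynomial growth; then $DF:=\sum_{i=1}^n\partial_if(W(h_1),\dots,W(h_n))\,h_i$. For $1\le p<\infty$,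 $\mathbb D^{1,p}$ is the closure of the set of smooth random variables under $\|F\|_{1,p}=(\mathbb E|F|^p+\mathbb E\|DF\|_{\mathcal H}^p)^{1/p}$, i.e. the set of those $F\in L^p(\Omega)$ for which there are smooth $F_k$ with $F_k\to F$ in $L^p(\Omega)$ and $DF_k$ convergent in $L^p(\Omega;\mathcal H)$. Finally, $F\in\mathbb D^{1,p}_{\mathrm{loc}}$ if there is a sequence $(\Omega_n,F_n)_{n\ge1}$ in $\mathcal F\times\mathbb D^{1,p}$ such that $\Omega_n\uparrow\Omega$ and $F_n=F$ almost surely on $\Omega_n$ for every $n$. Then every locally $\mathcal H$-differentiable random variable belongs to $\mathbb D^{1,2}_{\mathrm{loc}}$, that is, $$\mathcal C^1_{\mathcal H\text{-}\mathrm{loc}}\subset\mathbb D^{1,2}_{\mathrm{loc}}.$$ -/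

import Mathlib

open MeasureTheory ProbabilityTheory Filter Topology
open scoped ENNReal

namespace WienerSpace

section Defs

variable {Ω : Type*} [NormedAddCommGroup Ω] [NormedSpace ℝ Ω] [MeasurableSpace Ω] [BorelSpace Ω]

/-- The Cameron-Martin space `H` of a centred Gaussian measure `P` on a separable Banach space `Ω`,
in its isometric realization as the closure in `L²(P)` of the continuous linear functionals on `Ω`.
It carries the norm and inner product of `L²(P)`, and is identified with a subspace of `Ω` through
the injection `embed` below. (`StrongDual.toLpₗ P 2 ℓ` is the class of `ℓ` in
`L²(P)`; `P` has finite second moments by Fernique's theorem.) -/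
noncomputable abbrev CameronMartin (P : Measure Ω) : Submodule ℝ (Lp ℝ 2 P) :=
  (LinearMap.range (StrongDual.toLpₗ (𝕜 := ℝ) P 2)).topologicalClosure

/-- The isonormal Gaussian process `h ↦ W(h)` on the Cameron-Martin space. It extends
`ℓ ↦ ℓ` from the dual of `Ω` (whose image in `H` is dense) to all of `H` isometrically. `W(h)` is
defined up to `P`-null sets. -/
noncomputable def W {P : Measure Ω} (h : CameronMartin P) : Ω → ℝ := ((h : Lp ℝ 2 P) : Ω → ℝ)

/-- The canonical injection of the Cameron-Martin space into `Ω`, namely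
`h ↦ ∫ W(h)(ω) ω P(dω)` (Bochner integral in `Ω`). -/
noncomputable def embed {P : Measure Ω} (h : CameronMartin P) : Ω :=
  ∫ ω, W h ω • ω ∂P

/-- `F` is a locally `H`-differentiable random variable: it is measurable for the `P`-completion of
the Borel σ-algebra, and there is an almost surely positive random variable `q` such that
`h ↦ F (ω + h)` is continuously (Fréchet) differentiable on the open ball
`{h ∈ H : ‖h‖_H < q ω}`, for every `ω` (the ball is empty where `q ω = 0`). -/
def LocallyHDifferentiable (P : Measure Ω) (F : Ω → ℝ) : Prop :=
  NullMeasurable F P ∧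
  ∃ q : Ω → ℝ≥0∞, NullMeasurable q P ∧ (∀ᵐ ω ∂P, 0 < q ω) ∧
    ∀ ω, ContDiffOn ℝ 1 (fun h : CameronMartin P => F (ω + embed h))
      {h : CameronMartin P | ENNReal.ofReal ‖h‖ < q ω}

/-- `F` is the smooth random variable `f(W(h₁), …, W(hₙ))`, with `f` smooth and `f` and all its
partial derivatives of at most polynomial growth, and `DF` is its Malliavin derivative
`∑ i, ∂ᵢf(W(h₁), …, W(hₙ)) hᵢ`. -/
def IsSmoothWithDeriv (P : Measure Ω) (F : Ω → ℝ) (DF : Ω → CameronMartin P) : Prop :=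
  ∃ (n : ℕ) (h : Fin n → CameronMartin P) (f : (Fin n → ℝ) → ℝ),
    f.HasTemperateGrowth ∧
    (∀ᵐ ω ∂P, F ω = f (fun i => W (h i) ω)) ∧
    (∀ᵐ ω ∂P, DF ω = ∑ i, fderiv ℝ f (fun j => W (h j) ω) (Pi.single i 1) • h i)

/-- The Sobolev-Malliavin space `𝔻^{1,p}`, the closure of the smooth random variables under
`‖F‖_{1,p} = (E|F|^p + E‖DF‖_H^p)^{1/p}` (for `1 ≤ p < ∞`), i.e. the domain of the closure of `D`
from `L^p(P)` to `L^p(P; H)`: `F` belongs to it if some sequence of smooth random variables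
converges to `F` in `L^p(P)` while their derivatives converge in `L^p(P; H)`. -/
def MemSobolev (P : Measure Ω) (p : ℝ≥0∞) (F : Ω → ℝ) : Prop :=
  MemLp F p P ∧ ∃ η : Ω → CameronMartin P, MemLp η p P ∧
    ∃ (G : ℕ → Ω → ℝ) (DG : ℕ → Ω → CameronMartin P),
      (∀ k, IsSmoothWithDeriv P (G k) (DG k)) ∧
      Tendsto (fun k => eLpNorm (fun ω => G k ω - F ω) p P) atTop (𝓝 0) ∧
      Tendsto (fun k => eLpNorm (fun ω => DG k ω - η ω) p P) atTop (𝓝 0)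

/-- The localized space `𝔻^{1,p}_loc`: there are `(Ωₙ, Fₙ)`, with `Ωₙ` in the completed Borel
σ-algebra and `Fₙ ∈ 𝔻^{1,p}`, such that `Ωₙ ↑ Ω` and `Fₙ = F` almost surely on `Ωₙ`. -/
def MemSobolevLoc (P : Measure Ω) (p : ℝ≥0∞) (F : Ω → ℝ) : Prop :=
  ∃ (S : ℕ → Set Ω) (G : ℕ → Ω → ℝ),
    (∀ n, NullMeasurableSet (S n) P) ∧ (∀ n, MemSobolev P p (G n)) ∧
    Monotone S ∧ (⋃ n, S n) = Set.univ ∧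
    ∀ n, ∀ᵐ ω ∂P, ω ∈ S n → G n ω = F ω

end Defs

section Facts

variable {Ω : Type*} [NormedAddCommGroup Ω] [NormedSpace ℝ Ω] [CompleteSpace Ω]
  [TopologicalSpace.SeparableSpace Ω] [MeasurableSpace Ω] [BorelSpace Ω]
  {P : Measure Ω} [IsGaussian P]

/-- The Bochner integral defining the embedding always converges. -/
theorem integrable_embed (h : CameronMartin P) :
    Integrable (fun ω => W h ω • ω) P := by
  have := UniformSpace.secondCountable_of_separable Ω
  have h1 : MemLp (fun ω : Ω => ω) 2 P := IsGaussian.memLp_id P 2 (by norm_num)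
  exact memLp_one_iff_integrable.1 (h1.smul (Lp.memLp (h : Lp ℝ 2 P)))

/-- Evaluating a functional `ℓ` on the embedded `h` is the inner product of `h` with `ℓ`, which is
the defining property of the Cameron-Martin space. -/
theorem apply_embed (h : CameronMartin P) (ℓ : StrongDual ℝ Ω) :
    ℓ (embed h) = inner ℝ (h : Lp ℝ 2 P) (StrongDual.toLpₗ (𝕜 := ℝ) P 2 ℓ) := by
  have := UniformSpace.secondCountable_of_separable Ω
  have h1 : MemLp (id : Ω → Ω) 2 P := IsGaussian.memLp_id P 2 (by norm_num)
  rw [L2.inner_def, embed, ← ℓ.integral_comp_comm (integrable_embed h),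
    StrongDual.toLpₗ_apply h1]
  refine integral_congr_ae ?_
  filter_upwards [MemLp.coeFn_toLp (h1.continuousLinearMap_comp ℓ)] with ω hω
  change ℓ (W h ω • ω) = inner ℝ (W h ω) _
  refine Eq.trans ?_ (congrArg (inner ℝ (W h ω)) hω.symm)
  simp [mul_comm]

/-- The embedding of the Cameron-Martin space into `Ω` is injective. -/
theorem embed_injective :
    Function.Injective (embed : CameronMartin P → Ω) := by
  intro g h hgh
  have key : ∀ x ∈ CameronMartin P,
      inner ℝ ((g : Lp ℝ 2 P) - (h : Lp ℝ 2 P)) x = 0 := by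
    intro x hx
    have hcl : IsClosed {x : Lp ℝ 2 P | inner ℝ ((g : Lp ℝ 2 P) - (h : Lp ℝ 2 P)) x = 0} :=
      isClosed_eq (by fun_prop) continuous_const
    refine closure_minimal ?_ hcl hx
    rintro _ ⟨ℓ, rfl⟩
    show inner ℝ _ _ = (0 : ℝ)
    rw [inner_sub_left, ← apply_embed g ℓ, ← apply_embed h ℓ, hgh, sub_self]
  have := key _ ((CameronMartin P).sub_mem g.2 h.2)
  rw [inner_self_eq_zero, sub_eq_zero] at this
  exact Subtype.ext this

end Facts

end WienerSpace

/-! Differentiability at `h = 0` makes `F` locally Lipschitz along `H` at almost every point. Let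
`Aₙ` be the set where `|F| ≤ n` and `F` satisfies an `n`-Lipschitz estimate for increments shorter
than `1 / (n + 1)` in a countable group `S` of directions; these sets increase to `Ω` up to a null
set. Between points of `Aₙ` differing by an element of `S` the estimate becomes global, and a
McShane extension (`exists_lipschitz_extension`) gives a bounded `Gₙ`, Lipschitz along `S`, with `Gₙ
= F` almost surely on `Aₙ`.

It remains to see that such a `G` lies in `𝔻^{1,2}` (`memSobolev_of_lipschitz`). Given finitely many
functionals, the conditional expectation of `G` is a function on `ℝᵐ` which, by the Cameron-Martin
formula, inherits the Lipschitz constant (`ae_le_of_condExp_eq_comp`); mollifying it produces smooth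
random variables with gradient bounded by that constant. By martingale convergence they approximate
`G` in `L²`. Their derivatives are merely bounded in `L²`, and minimising the norm over a convex set
(`Convex.exists_seq_tendsto_of_bounded`) upgrades this to strong convergence. -/

namespace WienerSpace

/-! ### Cameron-Martin theorem for shifts coming from the dual. -/

section CameronMartinTheorem

variable {Ω : Type*} [NormedAddCommGroup Ω] [NormedSpace ℝ Ω] [CompleteSpace Ω]
  [TopologicalSpace.SeparableSpace Ω] [MeasurableSpace Ω] [BorelSpace Ω]
  {P : Measure Ω} [IsGaussian P]

/-- The element of the Cameron-Martin space given by a continuous linear functional. -/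
noncomputable def ofDual (P : Measure Ω) : StrongDual ℝ Ω →ₗ[ℝ] CameronMartin P :=
  (StrongDual.toLpₗ (𝕜 := ℝ) P 2).codRestrict _
    fun ℓ => Submodule.le_topologicalClosure _ (LinearMap.mem_range_self _ ℓ)

theorem W_ofDual (ℓ : StrongDual ℝ Ω) : W (ofDual P ℓ) =ᵐ[P] ℓ := by
  have := UniformSpace.secondCountable_of_separable Ω
  have h1 : MemLp (id : Ω → Ω) 2 P := IsGaussian.memLp_id P 2 (by norm_num)
  have : ((ofDual P ℓ : CameronMartin P) : Lp ℝ 2 P) =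
      (h1.continuousLinearMap_comp ℓ).toLp ℓ := StrongDual.toLpₗ_apply h1 ℓ
  unfold W
  rw [this]
  exact MemLp.coeFn_toLp _

theorem apply_embed_eq_inner (h : CameronMartin P) (ℓ : StrongDual ℝ Ω) :
    ℓ (embed h) = inner ℝ h (ofDual P ℓ) :=
  apply_embed h ℓ

theorem inner_ofDual (k ℓ : StrongDual ℝ Ω) :
    inner ℝ (ofDual P k) (ofDual P ℓ) = ∫ ω, k ω * ℓ ω ∂P := by
  change inner ℝ ((ofDual P k : CameronMartin P) : Lp ℝ 2 P) (ofDual P ℓ : CameronMartin P) = _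
  rw [L2.inner_def]
  refine integral_congr_ae ?_
  filter_upwards [W_ofDual (P := P) k, W_ofDual (P := P) ℓ] with ω h1 h2
  change inner ℝ (W (ofDual P k) ω) (W (ofDual P ℓ) ω) = _
  rw [h1, h2]
  simp [mul_comm]

theorem norm_ofDual_sq (ℓ : StrongDual ℝ Ω) : ‖ofDual P ℓ‖ ^ 2 = ∫ ω, ℓ ω ^ 2 ∂P := by
  rw [← real_inner_self_eq_norm_sq, inner_ofDual]
  simp only [sq]

theorem map_dual_eq_gaussianReal (hmean : ∀ ℓ : StrongDual ℝ Ω, ∫ ω, ℓ ω ∂P = 0)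
    (ℓ : StrongDual ℝ Ω) :
    P.map ℓ = gaussianReal 0 (‖ofDual P ℓ‖ ^ 2).toNNReal := by
  rw [IsGaussian.map_eq_gaussianReal ℓ, hmean,
    variance_of_integral_eq_zero (by fun_prop) (hmean ℓ), norm_ofDual_sq]

theorem integrable_exp_dual (hmean : ∀ ℓ : StrongDual ℝ Ω, ∫ ω, ℓ ω ∂P = 0)
    (ℓ : StrongDual ℝ Ω) : Integrable (fun ω => Real.exp (ℓ ω)) P := by
  have h := integrable_exp_mul_gaussianReal (μ := 0) (v := (‖ofDual P ℓ‖ ^ 2).toNNReal) 1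
  rw [← map_dual_eq_gaussianReal hmean] at h
  simpa [Function.comp_def] using h.comp_aemeasurable (by fun_prop)

theorem integral_exp_dual (hmean : ∀ ℓ : StrongDual ℝ Ω, ∫ ω, ℓ ω ∂P = 0)
    (ℓ : StrongDual ℝ Ω) :
    ∫ ω, Real.exp (ℓ ω) ∂P = Real.exp (‖ofDual P ℓ‖ ^ 2 / 2) := by
  have h := mgf_gaussianReal (map_dual_eq_gaussianReal hmean ℓ) 1
  simpa [mgf] using h

/-- The Cameron-Martin theorem, for shifts in the directions given by the dual of `Ω`. -/
theorem map_add_embed_ofDual (hmean : ∀ ℓ : StrongDual ℝ Ω, ∫ ω, ℓ ω ∂P = 0)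
    (k : StrongDual ℝ Ω) :
    P.map (fun ω => ω + embed (ofDual P k)) =
      P.withDensity fun ω => ENNReal.ofReal (Real.exp (k ω - ‖ofDual P k‖ ^ 2 / 2)) := by
  have := UniformSpace.secondCountable_of_separable Ω
  have hint (ℓ : StrongDual ℝ Ω) : Integrable
      (fun ω => Real.exp (k ω - ‖ofDual P k‖ ^ 2 / 2) * Real.exp (ℓ ω)) P := by
    convert (integrable_exp_dual hmean (k + ℓ)).mul_const (Real.exp (-‖ofDual P k‖ ^ 2 / 2))
      using 2 with ω
    rw [← Real.exp_add, ← Real.exp_add]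
    congr 1
    simp; ring
  have hfin : IsFiniteMeasure
      (P.withDensity fun ω => ENNReal.ofReal (Real.exp (k ω - ‖ofDual P k‖ ^ 2 / 2))) := by
    refine isFiniteMeasure_withDensity_ofReal ?_
    simpa using (hint 0).2
  have hprob : IsProbabilityMeasure (P.map (fun ω => ω + embed (ofDual P k))) :=
    Measure.isProbabilityMeasure_map (by fun_prop)
  refine Measure.ext_of_charFunDual (funext fun ℓ => ?_)
  -- The two measures are compared through real exponential moments of each functional, which
  -- `integral_exp_dual` makes explicit on both sides.
  have hmgf : mgf ℓ (P.map (fun ω => ω + embed (ofDual P k))) = mgf ℓ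
      (P.withDensity fun ω => ENNReal.ofReal (Real.exp (k ω - ‖ofDual P k‖ ^ 2 / 2))) := by
    ext t
    unfold mgf
    rw [integral_map (by fun_prop) (by fun_prop),
      integral_withDensity_eq_integral_toReal_smul (by fun_prop) (by simp)]
    have e1 : ∀ ω, Real.exp (t * ℓ (ω + embed (ofDual P k))) =
        Real.exp (t * inner ℝ (ofDual P k) (ofDual P ℓ)) * Real.exp ((t • ℓ) ω) := by
      intro ω
      rw [← Real.exp_add, map_add, apply_embed_eq_inner]
      congr 1
      simp; ring
    have e2 : ∀ ω, (ENNReal.ofReal (Real.exp (k ω - ‖ofDual P k‖ ^ 2 / 2))).toReal •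
        Real.exp (t * ℓ ω) = Real.exp (-‖ofDual P k‖ ^ 2 / 2) * Real.exp ((k + t • ℓ) ω) := by
      intro ω
      rw [ENNReal.toReal_ofReal (Real.exp_pos _).le, smul_eq_mul, ← Real.exp_add, ← Real.exp_add]
      congr 1
      simp; ring
    simp_rw [e1, e2]
    have e3 : inner ℝ (ofDual P k) (ofDual P (t • ℓ)) =
        t * inner ℝ (ofDual P k) (ofDual P ℓ) := by
      rw [← apply_embed_eq_inner, ← apply_embed_eq_inner]
      rfl
    rw [integral_const_mul, integral_const_mul, integral_exp_dual hmean, integral_exp_dual hmean,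
      ← Real.exp_add, ← Real.exp_add, map_add, norm_add_sq_real, e3, map_smul, norm_smul,
      mul_pow, Real.norm_eq_abs, sq_abs]
    congr 1
    ring
  -- All exponential moments are finite, so the equality of moment generating functions continues
  -- analytically to `Complex.I`, where it is equality of characteristic functionals.
  have huniv : integrableExpSet ℓ (P.map (fun ω => ω + embed (ofDual P k))) = Set.univ := by
    refine Set.eq_univ_of_forall fun t => ?_
    change Integrable _ _
    rw [integrable_map_measure (by fun_prop) (by fun_prop)]
    convert (integrable_exp_dual hmean (t • ℓ)).mul_const
      (Real.exp (t * ℓ (embed (ofDual P k)))) using 2 with ω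
    rw [Function.comp_apply, ← Real.exp_add]
    congr 1
    simp; ring
  have := eqOn_complexMGF_of_mgf hmgf (x := Complex.I) (by simp [huniv])
  simpa [complexMGF, charFunDual_apply, mul_comm] using this

theorem integrable_exp_sub_dual (hmean : ∀ ℓ : StrongDual ℝ Ω, ∫ ω, ℓ ω ∂P = 0)
    (k : StrongDual ℝ Ω) :
    Integrable (fun ω => Real.exp (k ω - ‖ofDual P k‖ ^ 2 / 2)) P := by
  simp_rw [Real.exp_sub]
  exact (integrable_exp_dual hmean k).div_const _

/-- The Cameron-Martin formula. -/
theorem integral_comp_add_embed (hmean : ∀ ℓ : StrongDual ℝ Ω, ∫ ω, ℓ ω ∂P = 0)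
    (k : StrongDual ℝ Ω) {f : Ω → ℝ} (hf : Measurable f) :
    ∫ ω, f (ω + embed (ofDual P k)) ∂P =
      ∫ ω, Real.exp (k ω - ‖ofDual P k‖ ^ 2 / 2) * f ω ∂P := by
  have h := integral_map (μ := P) (φ := fun ω => ω + embed (ofDual P k)) (by fun_prop)
    hf.aestronglyMeasurable
  rw [← h, map_add_embed_ofDual hmean,
    integral_withDensity_eq_integral_toReal_smul (by fun_prop) (by simp)]
  simp [ENNReal.toReal_ofReal (Real.exp_pos _).le]

theorem quasiMeasurePreserving_add_embed (hmean : ∀ ℓ : StrongDual ℝ Ω, ∫ ω, ℓ ω ∂P = 0)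
    (k : StrongDual ℝ Ω) :
    Measure.QuasiMeasurePreserving (fun ω => ω + embed (ofDual P k)) P P := by
  refine ⟨by fun_prop, ?_⟩
  rw [map_add_embed_ofDual hmean]
  exact withDensity_absolutelyContinuous _ _

end CameronMartinTheorem

end WienerSpace

/-! ### Strong convergence of derivatives from boundedness, by convexity. -/

/-- If a convex set contains points whose first components approach `x` while their second
components remain bounded in a Hilbert space, then some sequence in the set has first components
converging to `x` and converging second components. -/
theorem Convex.exists_seq_tendsto_of_bounded {X Y : Type*} [NormedAddCommGroup X]
    [NormedSpace ℝ X] [NormedAddCommGroup Y] [InnerProductSpace ℝ Y] [CompleteSpace Y]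
    {Γ : Set (X × Y)} (hΓ : Convex ℝ Γ) (x : X) (C : ℝ)
    (h : ∀ ε > 0, ∃ p ∈ Γ, ‖p.1 - x‖ < ε ∧ ‖p.2‖ ≤ C) :
    ∃ (y : Y) (p : ℕ → X × Y), (∀ n, p n ∈ Γ) ∧
      Tendsto (fun n => (p n).1) atTop (𝓝 x) ∧ Tendsto (fun n => (p n).2) atTop (𝓝 y) := by
  -- `I n = inf S n` is the least norm of a second component among points whose first component is
  -- `1 / (n + 1)`-close to `x`. It increases and is bounded by `C`, hence converges;
  -- near-minimisers will be Cauchy.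
  let S : ℕ → Set ℝ := fun n => {r | ∃ p ∈ Γ, ‖p.1 - x‖ < 1 / ((n : ℝ) + 1) ∧ ‖p.2‖ = r}
  have hSbdd (n) : BddBelow (S n) := ⟨0, by rintro _ ⟨p, -, -, rfl⟩; exact norm_nonneg _⟩
  have hSne (n : ℕ) : ∃ r ∈ S n, r ≤ C := by
    obtain ⟨p, hp, hp1, hp2⟩ := h (1 / ((n : ℝ) + 1)) (by positivity)
    exact ⟨_, ⟨p, hp, hp1, rfl⟩, hp2⟩
  have hSne' (n : ℕ) : (S n).Nonempty := let ⟨r, hr, _⟩ := hSne n; ⟨r, hr⟩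
  have hSanti {m n : ℕ} (hmn : m ≤ n) : S n ⊆ S m := by
    rintro _ ⟨p, hp, hp1, rfl⟩
    exact ⟨p, hp, hp1.trans_le (one_div_le_one_div_of_le (by positivity) (by gcongr)), rfl⟩
  let I : ℕ → ℝ := fun n => sInf (S n)
  have hImono : Monotone I := fun m n hmn => csInf_le_csInf (hSbdd m) (hSne' n) (hSanti hmn)
  have hI0 (n) : 0 ≤ I n := le_csInf (hSne' n) (by rintro _ ⟨p, -, -, rfl⟩; exact norm_nonneg _)
  have hIC (n) : I n ≤ C := let ⟨r, hr, hrC⟩ := hSne n; (csInf_le (hSbdd n) hr).trans hrC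
  have hIbdd : BddAbove (Set.range I) := ⟨C, by rintro _ ⟨n, rfl⟩; exact hIC n⟩
  have hIlim := tendsto_atTop_ciSup hImono hIbdd
  set J := ⨆ n, I n
  have hIJ (n) : I n ≤ J := le_ciSup hIbdd n
  have hex (n : ℕ) : ∃ p ∈ Γ, ‖p.1 - x‖ < 1 / ((n : ℝ) + 1) ∧ ‖p.2‖ < I n + 1 / ((n : ℝ) + 1) := by
    obtain ⟨_, ⟨p, hp, hp1, rfl⟩, hlt⟩ := exists_lt_of_csInf_lt (hSne' n)
      (show I n < I n + 1 / ((n : ℝ) + 1) from lt_add_of_pos_right _ (by positivity))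
    exact ⟨p, hp, hp1, hlt⟩
  choose p hpΓ hp1 hp2 using hex
  have hdec {m n : ℕ} (hmn : m ≤ n) : 1 / ((n : ℝ) + 1) ≤ 1 / ((m : ℝ) + 1) :=
    one_div_le_one_div_of_le (by positivity) (by gcongr)
  have hlim0 : Tendsto (fun n : ℕ => 1 / ((n : ℝ) + 1)) atTop (𝓝 0) :=
    tendsto_one_div_add_atTop_nhds_zero_nat
  have key (n m : ℕ) (hnm : n ≤ m) :
      dist (p n).2 (p m).2 ≤ √(4 * (J + 1 / ((n : ℝ) + 1)) ^ 2 - 4 * I n ^ 2) := by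
    refine Real.le_sqrt_of_sq_le ?_
    -- The midpoint of `p n` and `p m` lies in `Γ` and is still `1 / (n + 1)`-close to `x`, so its
    -- norm is at least `I n`; the parallelogram law then bounds the distance.
    have hmid : I n ≤ ‖(1 / 2 : ℝ) • (p n).2 + (1 / 2 : ℝ) • (p m).2‖ := by
      refine csInf_le (hSbdd n) ⟨(1 / 2 : ℝ) • p n + (1 / 2 : ℝ) • p m,
        hΓ (hpΓ n) (hpΓ m) (by norm_num) (by norm_num) (by norm_num), ?_, rfl⟩
      have : ((1 / 2 : ℝ) • p n + (1 / 2 : ℝ) • p m).1 - x =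
          (1 / 2 : ℝ) • ((p n).1 - x) + (1 / 2 : ℝ) • ((p m).1 - x) := by
        simp only [Prod.fst_add, Prod.smul_fst]
        module
      rw [this]
      refine (norm_add_le _ _).trans_lt ?_
      rw [norm_smul, norm_smul]
      have := hp1 n
      have := (hp1 m).trans_le (hdec hnm)
      norm_num at *
      linarith
    have hpar := parallelogram_law_with_norm ℝ (p n).2 (p m).2
    have h1 : ‖(p n).2‖ ≤ J + 1 / ((n : ℝ) + 1) := (hp2 n).le.trans (by gcongr; exact hIJ n)
    have h2 : ‖(p m).2‖ ≤ J + 1 / ((n : ℝ) + 1) :=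
      (hp2 m).le.trans (add_le_add (hIJ m) (hdec hnm))
    have h3 : ‖(p n).2‖ ^ 2 ≤ (J + 1 / ((n : ℝ) + 1)) ^ 2 := by gcongr
    have h4 : ‖(p m).2‖ ^ 2 ≤ (J + 1 / ((n : ℝ) + 1)) ^ 2 := by gcongr
    rw [← smul_add, norm_smul] at hmid
    have h5 : I n ^ 2 ≤ (‖(1 / 2 : ℝ)‖ * ‖(p n).2 + (p m).2‖) ^ 2 := by
      have := hI0 n
      gcongr
    norm_num [mul_pow] at h5
    rw [dist_eq_norm]
    nlinarith
  have hcauchy : CauchySeq (fun n => (p n).2) := by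
    refine cauchySeq_of_le_tendsto_0
      (fun N : ℕ => 2 * √(4 * (J + 1 / ((N : ℝ) + 1)) ^ 2 - 4 * I N ^ 2))
      (fun n m N hn hm => ?_) ?_
    · refine (dist_triangle_left _ _ (p N).2).trans ?_
      have := key N n hn
      have := key N m hm
      linarith
    · have : Tendsto (fun N : ℕ => 2 * √(4 * (J + 1 / ((N : ℝ) + 1)) ^ 2 - 4 * I N ^ 2)) atTop
          (𝓝 (2 * √(4 * (J + 0) ^ 2 - 4 * J ^ 2))) :=
        ((((hlim0.const_add J).pow 2).const_mul 4).sub ((hIlim.pow 2).const_mul 4)).sqrt.const_mul 2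
      simpa using this
  obtain ⟨y, hy⟩ := cauchySeq_tendsto_of_complete hcauchy
  refine ⟨y, p, hpΓ, ?_, hy⟩
  rw [tendsto_iff_norm_sub_tendsto_zero]
  exact squeeze_zero (fun _ => norm_nonneg _) (fun n => (hp1 n).le) hlim0

namespace WienerSpace

variable {Ω : Type*} [NormedAddCommGroup Ω] [NormedSpace ℝ Ω] [MeasurableSpace Ω]
  {P : Measure Ω}

theorem IsSmoothWithDeriv.congr {F F' : Ω → ℝ} {D D' : Ω → CameronMartin P}
    (h : IsSmoothWithDeriv P F D) (hF : F' =ᵐ[P] F) (hD : D' =ᵐ[P] D) :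
    IsSmoothWithDeriv P F' D' := by
  obtain ⟨n, k, f, hf, h1, h2⟩ := h
  exact ⟨n, k, f, hf, by filter_upwards [hF, h1] with ω a b using a.trans b,
    by filter_upwards [hD, h2] with ω a b using a.trans b⟩

/-- Concatenating the two families of directions puts both functions on `ℝ^(m+n)`, with `L` and `R`
the projections to the two blocks. This makes the set of pairs `(F, DF)` convex. -/
theorem IsSmoothWithDeriv.linear_combination {F₁ F₂ : Ω → ℝ} {D₁ D₂ : Ω → CameronMartin P}
    (h₁ : IsSmoothWithDeriv P F₁ D₁) (h₂ : IsSmoothWithDeriv P F₂ D₂) (a b : ℝ) :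
    IsSmoothWithDeriv P (fun ω => a * F₁ ω + b * F₂ ω) (fun ω => a • D₁ ω + b • D₂ ω) := by
  obtain ⟨m, k, f, hf, hF₁, hD₁⟩ := h₁
  obtain ⟨n, l, g, hg, hF₂, hD₂⟩ := h₂
  let L : (Fin (m + n) → ℝ) →L[ℝ] (Fin m → ℝ) :=
    ContinuousLinearMap.pi fun i => ContinuousLinearMap.proj (Fin.castAdd n i)
  let R : (Fin (m + n) → ℝ) →L[ℝ] (Fin n → ℝ) :=
    ContinuousLinearMap.pi fun i => ContinuousLinearMap.proj (Fin.natAdd m i)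
  have hfd : Differentiable ℝ f := hf.1.differentiable (by simp)
  have hgd : Differentiable ℝ g := hg.1.differentiable (by simp)
  have hderiv (x v : Fin (m + n) → ℝ) : fderiv ℝ (fun y => a * f (L y) + b * g (R y)) x v =
      a * fderiv ℝ f (L x) (L v) + b * fderiv ℝ g (R x) (R v) := by
    have h1 : HasFDerivAt (fun y => f (L y)) ((fderiv ℝ f (L x)).comp L) x :=
      (hfd (L x)).hasFDerivAt.comp x L.hasFDerivAt
    have h2 : HasFDerivAt (fun y => g (R y)) ((fderiv ℝ g (R x)).comp R) x :=
      (hgd (R x)).hasFDerivAt.comp x R.hasFDerivAt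
    have h3 : HasFDerivAt (fun y => a * f (L y) + b * g (R y)) _ x :=
      (h1.const_mul a).add (h2.const_mul b)
    rw [h3.fderiv]
    simp
  have hL1 (i : Fin m) : L (Pi.single (Fin.castAdd n i) 1) = Pi.single i 1 := by
    ext j
    simp [L, Pi.single_apply, Fin.ext_iff]
  have hL2 (i : Fin n) : L (Pi.single (Fin.natAdd m i) 1) = 0 := by
    ext j
    have := j.2
    simp [L, Pi.single_apply, Fin.ext_iff]
    omega
  have hR1 (i : Fin m) : R (Pi.single (Fin.castAdd n i) 1) = 0 := by
    ext j
    have := i.2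
    simp [R, Pi.single_apply, Fin.ext_iff]
    omega
  have hR2 (i : Fin n) : R (Pi.single (Fin.natAdd m i) 1) = Pi.single i 1 := by
    ext j
    simp [R, Pi.single_apply, Fin.ext_iff]
  have hLW (ω : Ω) : L (fun j => W (Fin.append k l j) ω) = fun j => W (k j) ω := by
    ext j; simp [L]
  have hRW (ω : Ω) : R (fun j => W (Fin.append k l j) ω) = fun j => W (l j) ω := by
    ext j; simp [R]
  refine ⟨m + n, Fin.append k l, fun y => a * f (L y) + b * g (R y), ?_, ?_, ?_⟩
  · exact ((Function.HasTemperateGrowth.const a).mul (hf.comp L.hasTemperateGrowth)).add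
      ((Function.HasTemperateGrowth.const b).mul (hg.comp R.hasTemperateGrowth))
  · filter_upwards [hF₁, hF₂] with ω h1 h2
    rw [h1, h2, hLW, hRW]
  · filter_upwards [hD₁, hD₂] with ω h1 h2
    rw [h1, h2, Fin.sum_univ_add]
    simp only [hderiv, hL1, hL2, hR1, hR2, hLW, hRW, Fin.append_left, Fin.append_right, map_zero,
      mul_zero, add_zero, zero_add, Finset.smul_sum, smul_smul]


end WienerSpace

/-- `L²` version of `Convex.exists_seq_tendsto_of_bounded`, for a relation between functions which
is stable under modification on null sets and under linear combinations. -/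
theorem MeasureTheory.exists_seq_tendsto_of_bounded_eLpNorm {Ω H : Type*} [MeasurableSpace Ω]
    {P : Measure Ω} [NormedAddCommGroup H] [InnerProductSpace ℝ H] [CompleteSpace H]
    {R : (Ω → ℝ) → (Ω → H) → Prop}
    (hcongr : ∀ {F F' D D'}, R F D → F' =ᵐ[P] F → D' =ᵐ[P] D → R F' D')
    (hlin : ∀ {F₁ F₂ D₁ D₂}, R F₁ D₁ → R F₂ D₂ → ∀ a b : ℝ,
      R (fun ω => a * F₁ ω + b * F₂ ω) (fun ω => a • D₁ ω + b • D₂ ω))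
    {G : Ω → ℝ} (hG : MemLp G 2 P) (C : ℝ)
    (h : ∀ ε : ℝ, 0 < ε → ∃ (F : Ω → ℝ) (D : Ω → H), R F D ∧
      MemLp F 2 P ∧ MemLp D 2 P ∧ eLpNorm (F - G) 2 P < ENNReal.ofReal ε ∧
      eLpNorm D 2 P ≤ ENNReal.ofReal C) :
    ∃ η : Ω → H, MemLp η 2 P ∧ ∃ (F : ℕ → Ω → ℝ) (D : ℕ → Ω → H), (∀ k, R (F k) (D k)) ∧
      Tendsto (fun k => eLpNorm (fun ω => F k ω - G ω) 2 P) atTop (𝓝 0) ∧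
      Tendsto (fun k => eLpNorm (fun ω => D k ω - η ω) 2 P) atTop (𝓝 0) := by
  let Γ : Set (Lp ℝ 2 P × Lp H 2 P) := {p | R p.1 p.2}
  have hΓ : Convex ℝ Γ := by
    intro p hp q hq a b _ _ _
    refine hcongr (hlin hp hq a b) ?_ ?_
    · filter_upwards [Lp.coeFn_add (a • p.1) (b • q.1), Lp.coeFn_smul a p.1,
        Lp.coeFn_smul b q.1] with ω h1 h2 h3
      change (a • p.1 + b • q.1 : Lp ℝ 2 P) ω = _
      rw [h1, Pi.add_apply, h2, h3]
      rfl
    · filter_upwards [Lp.coeFn_add (a • p.2) (b • q.2), Lp.coeFn_smul a p.2,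
        Lp.coeFn_smul b q.2] with ω h1 h2 h3
      change (a • p.2 + b • q.2 : Lp H 2 P) ω = _
      rw [h1, Pi.add_apply, h2, h3]
      rfl
  -- `max C 0` covers negative `C`, for which `ENNReal.ofReal C` is `0`.
  obtain ⟨y, p, hp, hp1, hp2⟩ := hΓ.exists_seq_tendsto_of_bounded (hG.toLp G) (max C 0) (by
    intro ε hε
    obtain ⟨F, D, hFD, hF, hD, hε1, hC⟩ := h ε hε
    refine ⟨(hF.toLp F, hD.toLp D), hcongr hFD hF.coeFn_toLp hD.coeFn_toLp, ?_, ?_⟩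
    · change ‖hF.toLp F - hG.toLp G‖ < ε
      rw [← MemLp.toLp_sub, Lp.norm_toLp]
      exact (ENNReal.lt_ofReal_iff_toReal_lt hε1.ne_top).1 hε1
    · change ‖hD.toLp D‖ ≤ _
      rw [Lp.norm_toLp]
      refine ENNReal.toReal_le_of_le_ofReal (le_max_right _ _) (hC.trans ?_)
      gcongr
      exact le_max_left _ _)
  refine ⟨y, Lp.memLp y, fun n => (p n).1, fun n => (p n).2, hp, ?_, ?_⟩
  · rw [Lp.tendsto_Lp_iff_tendsto_eLpNorm'] at hp1
    refine hp1.congr fun n => eLpNorm_congr_ae ?_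
    filter_upwards [hG.coeFn_toLp] with ω h1
    simp [h1]
  · exact (Lp.tendsto_Lp_iff_tendsto_eLpNorm' _ _).1 hp2

namespace WienerSpace

variable {Ω : Type*} [NormedAddCommGroup Ω] [NormedSpace ℝ Ω] [MeasurableSpace Ω]
  {P : Measure Ω}

/-- A square integrable function is in `𝔻^{1,2}` as soon as it is approximated in `L²` by smooth
random variables with bounded derivatives in `L²`. -/
theorem memSobolev_of_bounded_deriv {G : Ω → ℝ} (hG : MemLp G 2 P) (C : ℝ)
    (h : ∀ ε : ℝ, 0 < ε → ∃ (F : Ω → ℝ) (D : Ω → CameronMartin P), IsSmoothWithDeriv P F D ∧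
      MemLp F 2 P ∧ MemLp D 2 P ∧ eLpNorm (F - G) 2 P < ENNReal.ofReal ε ∧
      eLpNorm D 2 P ≤ ENNReal.ofReal C) :
    MemSobolev P 2 G :=
  ⟨hG, exists_seq_tendsto_of_bounded_eLpNorm IsSmoothWithDeriv.congr
    IsSmoothWithDeriv.linear_combination hG C h⟩

end WienerSpace

/-! ### Smoothing bounded functions on finite-dimensional spaces. -/

section Mollification

open scoped Convolution ContDiff

/-- The iterated derivatives of the convolution of a bounded function with a compactly supported
smooth function are bounded. -/
theorem MeasureTheory.exists_norm_iteratedFDeriv_convolution_le {V : Type} [NormedAddCommGroup V]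
    [NormedSpace ℝ V] [MeasurableSpace V] [BorelSpace V] [FiniteDimensional ℝ V]
    {μ : Measure V} [μ.IsAddHaarMeasure] {g : V → ℝ} (hg : Measurable g) {B : ℝ}
    (hB : ∀ x, |g x| ≤ B) (k : ℕ) {E F : Type} [NormedAddCommGroup E] [NormedSpace ℝ E]
    [NormedAddCommGroup F] [NormedSpace ℝ F] (L : ℝ →L[ℝ] E →L[ℝ] F) {φ : V → E}
    (hcφ : HasCompactSupport φ) (hφ : ContDiff ℝ ∞ φ) :
    ∃ M, ∀ x, ‖iteratedFDeriv ℝ k (g ⋆[L, μ] φ) x‖ ≤ M := by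
  have hgl : LocallyIntegrable g μ :=
    (locallyIntegrable_const B).mono hg.aestronglyMeasurable
      (ae_of_all _ fun x => (hB x).trans (le_abs_self B))
  -- Differentiating the convolution replaces `φ` by `fderiv ℝ φ`, which takes values in another
  -- space; hence the generalization over `E` and `F`.
  induction k generalizing E F with
  | zero =>
    refine ⟨∫ t, ‖L‖ * B * ‖φ t‖ ∂μ, fun x => ?_⟩
    rw [norm_iteratedFDeriv_zero, convolution_def,
      ← integral_sub_left_eq_self (fun t => ‖L‖ * B * ‖φ t‖) μ x]
    refine norm_integral_le_of_norm_le ?_ (ae_of_all _ fun t => ?_)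
    · exact ((hφ.continuous.norm.integrable_of_hasCompactSupport hcφ.norm).const_mul
        _).comp_sub_left x
    · refine (L.le_opNorm₂ _ _).trans ?_
      gcongr
      exact hB t
  | succ k ih =>
    obtain ⟨M, hM⟩ := ih (L.precompR V) (hcφ.fderiv ℝ) (hφ.fderiv_right (by simp))
    refine ⟨M, fun x => ?_⟩
    have : fderiv ℝ (g ⋆[L, μ] φ) = g ⋆[L.precompR V, μ] fderiv ℝ φ := funext fun x =>
      (hcφ.hasFDerivAt_convolution_right L hgl (hφ.of_le (by simp)) x).fderiv
    rw [← norm_iteratedFDeriv_fderiv, this]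
    exact hM x

/-- Mollification of a bounded measurable function. -/
theorem exists_mollification {m : ℕ} {g : (Fin m → ℝ) → ℝ} (hg : Measurable g) {B : ℝ}
    (hB : ∀ x, |g x| ≤ B) :
    ∃ f : ℕ → (Fin m → ℝ) → ℝ, (∀ n, (f n).HasTemperateGrowth) ∧ (∀ n x, |f n x| ≤ B) ∧
      (∀ (a : Fin m → ℝ) (C : ℝ), (∀ᵐ x, g (x + a) ≤ g x + C) →
        ∀ n x, f n (x + a) ≤ f n x + C) ∧
      ∀ᵐ x, Tendsto (fun n => f n x) atTop (𝓝 (g x)) := by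
  have hgl : LocallyIntegrable g volume :=
    (locallyIntegrable_const B).mono hg.aestronglyMeasurable
      (ae_of_all _ fun x => (hB x).trans (le_abs_self B))
  -- The ratio of outer to inner radius stays equal to `2`, as required for almost everywhere
  -- convergence (`K := 2` below).
  let φ : ℕ → ContDiffBump (0 : Fin m → ℝ) := fun n =>
    ⟨1 / ((n : ℝ) + 1), 2 * (1 / ((n : ℝ) + 1)), by positivity,
      lt_two_mul_self (by positivity)⟩
  let f : ℕ → (Fin m → ℝ) → ℝ := fun n =>
    (φ n).normed volume ⋆[ContinuousLinearMap.lsmul ℝ ℝ, volume] g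
  have hfdef (n x) : f n x = ∫ t, (φ n).normed volume t * g (x - t) := rfl
  have hint (n x) : Integrable (fun t => (φ n).normed volume t * g (x - t)) :=
    (φ n).integrable_normed.mul_bdd (c := B)
      (hg.comp (measurable_const.sub measurable_id)).aestronglyMeasurable
      (ae_of_all _ fun t => hB _)
  refine ⟨f, fun n => ⟨?_, fun k => ?_⟩, fun n x => ?_, fun a C hC n x => ?_, ?_⟩
  · exact ((φ n).hasCompactSupport_normed (μ := volume)).contDiff_convolution_left _
      (φ n).contDiff_normed hgl
  · obtain ⟨M, hM⟩ := exists_norm_iteratedFDeriv_convolution_le (μ := volume) hg hB k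
      (ContinuousLinearMap.lsmul ℝ ℝ).flip ((φ n).hasCompactSupport_normed (μ := volume))
      (φ n).contDiff_normed
    rw [convolution_flip] at hM
    exact ⟨0, M, fun x => by simpa using hM x⟩
  · rw [hfdef, ← Real.norm_eq_abs]
    have : ∫ t, (φ n).normed volume t * B = B := by
      rw [integral_mul_const, (φ n).integral_normed, one_mul]
    rw [← this]
    refine norm_integral_le_of_norm_le ((φ n).integrable_normed.mul_const B)
      (ae_of_all _ fun t => ?_)
    rw [norm_mul, Real.norm_of_nonneg ((φ n).nonneg_normed t)]
    gcongr
    · exact (φ n).nonneg_normed t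
    · exact hB _
  · have h1 : f n x + C = ∫ t, ((φ n).normed volume t * g (x - t) + (φ n).normed volume t * C) := by
      rw [integral_add (hint n x) ((φ n).integrable_normed.mul_const C), integral_mul_const,
        (φ n).integral_normed, one_mul]
      rfl
    rw [h1, hfdef]
    refine integral_mono_ae (hint n _)
      ((hint n x).add ((φ n).integrable_normed.mul_const C)) ?_
    have hqmp : Measure.QuasiMeasurePreserving (fun t : Fin m → ℝ => x - t) volume volume :=
      quasiMeasurePreserving_sub_left volume x
    filter_upwards [hqmp.ae hC] with t ht
    rw [← mul_add, add_sub_right_comm]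
    exact mul_le_mul_of_nonneg_left ht ((φ n).nonneg_normed t)
  · refine ContDiffBump.ae_convolution_tendsto_right_of_locallyIntegrable (K := 2) ?_
      (Eventually.of_forall fun n => le_rfl) hgl
    have := (tendsto_one_div_add_atTop_nhds_zero_nat (𝕜 := ℝ)).const_mul 2
    rwa [mul_zero] at this

end Mollification

/-! ### Two measure-theoretic tools: quasi-invariance and bounded convergence. -/

/-- A nonzero finite measure which is quasi-invariant under all translations has the same null sets
as Lebesgue measure. -/
theorem MeasureTheory.Measure.absolutelyContinuous_addHaar_of_forall_quasiMeasurePreserving_add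
    {V : Type*} [AddCommGroup V] [MeasurableSpace V] [MeasurableAdd₂ V] [MeasurableNeg V]
    {μ ν : Measure V} [IsFiniteMeasure μ] [NeZero μ] [SigmaFinite ν] [NeZero ν]
    [ν.IsAddLeftInvariant]
    (h : ∀ a, Measure.QuasiMeasurePreserving (fun x => x + a) μ μ) : μ ≪ ν ∧ ν ≪ μ := by
  -- Both sides are the `μ × ν` measure of `{(x, a) | x + a ∈ A}`, computed by slicing in either
  -- order.
  have key {A : Set V} (hA : MeasurableSet A) :
      ∫⁻ a, μ ((fun x => x + a) ⁻¹' A) ∂ν = ν A * μ Set.univ := by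
    have hS : MeasurableSet {p : V × V | p.1 + p.2 ∈ A} := measurable_add hA
    have h1 := Measure.prod_apply (μ := μ) (ν := ν) hS
    rw [Measure.prod_apply_symm hS] at h1
    change ∫⁻ a, μ ((fun x => x + a) ⁻¹' A) ∂ν = ∫⁻ x, ν ((fun a => x + a) ⁻¹' A) ∂μ at h1
    rw [h1]
    simp_rw [measure_preimage_add]
    rw [lintegral_const]
  constructor
  · refine Measure.AbsolutelyContinuous.mk fun A hA hνA => ?_
    have h1 := key hA
    have hS : MeasurableSet {p : V × V | p.1 + p.2 ∈ A} := measurable_add hA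
    have hm : Measurable fun a => μ ((fun x => x + a) ⁻¹' A) := measurable_measure_prodMk_right hS
    rw [hνA, zero_mul, lintegral_eq_zero_iff hm] at h1
    obtain ⟨a, ha⟩ := h1.exists
    have h2 := (h (-a)).preimage_null ha
    rw [← Set.preimage_comp] at h2
    simpa [Function.comp_def] using h2
  · refine Measure.AbsolutelyContinuous.mk fun A hA hμA => ?_
    have h1 := key hA
    simp_rw [fun a => (h a).preimage_null hμA, lintegral_zero] at h1
    simpa [NeZero.ne μ] using h1.symm

/-- Bounded convergence in `L^p`. -/
theorem MeasureTheory.tendsto_eLpNorm_sub_of_ae_bdd {α : Type*} [MeasurableSpace α] {μ : Measure α}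
    [IsFiniteMeasure μ] {f : ℕ → α → ℝ} {g : α → ℝ} {B : ℝ}
    (hf : ∀ n, AEStronglyMeasurable (f n) μ) (hg : AEStronglyMeasurable g μ)
    (hfB : ∀ n, ∀ᵐ x ∂μ, |f n x| ≤ B) (hgB : ∀ᵐ x ∂μ, |g x| ≤ B)
    (hlim : ∀ᵐ x ∂μ, Tendsto (fun n => f n x) atTop (𝓝 (g x))) :
    Tendsto (fun n => eLpNorm (f n - g) 2 μ) atTop (𝓝 0) := by
  have h1 : Tendsto (fun n => ∫⁻ x, ‖f n x - g x‖ₑ ^ (2 : ℝ) ∂μ) atTop (𝓝 (∫⁻ _, 0 ∂μ)) := by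
    refine tendsto_lintegral_of_dominated_convergence' (fun _ => ENNReal.ofReal (2 * B) ^ (2 : ℝ))
      (fun n => ((hf n).sub hg).enorm.pow_const _) (fun n => ?_) ?_ ?_
    · filter_upwards [hfB n, hgB] with x h1 h2
      gcongr
      rw [Real.enorm_eq_ofReal_abs]
      refine ENNReal.ofReal_le_ofReal ((abs_sub _ _).trans ?_)
      linarith
    · rw [lintegral_const]
      exact ENNReal.mul_ne_top (ENNReal.rpow_ne_top_of_nonneg zero_le_two ENNReal.ofReal_ne_top)
        (measure_ne_top _ _)
    · filter_upwards [hlim] with x hx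
      have : Tendsto (fun n => ‖f n x - g x‖ₑ) atTop (𝓝 0) := by
        have := (hx.sub_const (g x)).enorm
        simpa using this
      simpa [Function.comp_def] using
        (ENNReal.continuous_rpow_const (y := 2)).continuousAt.tendsto.comp this
  rw [lintegral_zero] at h1
  simp_rw [eLpNorm_eq_lintegral_rpow_enorm_toReal two_ne_zero ENNReal.ofNat_ne_top]
  simpa [Function.comp_def] using
    (ENNReal.continuous_rpow_const (y := 1 / 2)).continuousAt.tendsto.comp h1

/-! ### Conditional expectation given finitely many functionals. -/

namespace WienerSpace

variable {Ω : Type*} [NormedAddCommGroup Ω] [NormedSpace ℝ Ω] [CompleteSpace Ω]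
  [TopologicalSpace.SeparableSpace Ω] [MeasurableSpace Ω] [BorelSpace Ω]
  {P : Measure Ω} [IsGaussian P] {m : ℕ} {k : Fin m → StrongDual ℝ Ω}

/-- Orthonormality turns a Cameron-Martin shift into a translation by `a` of the coordinates. -/
theorem apply_add_embed_sum_smul (hk : Orthonormal ℝ fun j => ofDual P (k j)) (a : Fin m → ℝ)
    (ω : Ω) :
    (fun j => k j (ω + embed (ofDual P (∑ i, a i • k i)))) = (fun j => k j ω) + a := by
  ext j
  rw [map_add, apply_embed_eq_inner, map_sum]
  simp_rw [map_smul]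
  rw [hk.inner_left_fintype a j]
  simp

theorem quasiMeasurePreserving_map_add (hmean : ∀ ℓ : StrongDual ℝ Ω, ∫ ω, ℓ ω ∂P = 0)
    (hk : Orthonormal ℝ fun j => ofDual P (k j)) (a : Fin m → ℝ) :
    Measure.QuasiMeasurePreserving (fun x => x + a) (P.map fun ω j => k j ω)
      (P.map fun ω j => k j ω) := by
  have hX : Measurable fun ω j => k j ω := by fun_prop
  refine ⟨by fun_prop, Measure.AbsolutelyContinuous.mk fun A hA hA0 => ?_⟩
  rw [Measure.map_apply hX hA] at hA0
  rw [Measure.map_apply (by fun_prop) hA, Measure.map_apply hX (hA.preimage (by fun_prop))]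
  convert (quasiMeasurePreserving_add_embed hmean (∑ i, a i • k i)).preimage_null hA0 using 2
  ext ω
  simp only [Set.mem_preimage, apply_add_embed_sum_smul hk]

/-- Quasi-invariance suffices, without computing the density. Both directions are needed: one brings
almost everywhere convergence of mollifiers back to `P`, the other moves the Lipschitz bound to
Lebesgue measure. -/
theorem map_dual_absolutelyContinuous (hmean : ∀ ℓ : StrongDual ℝ Ω, ∫ ω, ℓ ω ∂P = 0)
    (hk : Orthonormal ℝ fun j => ofDual P (k j)) :
    (P.map fun ω j => k j ω) ≪ volume ∧ volume ≪ (P.map fun ω j => k j ω) := by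
  have : IsProbabilityMeasure (P.map fun ω j => k j ω) :=
    Measure.isProbabilityMeasure_map (by fun_prop)
  exact Measure.absolutelyContinuous_addHaar_of_forall_quasiMeasurePreserving_add
    (quasiMeasurePreserving_map_add hmean hk)

/-- Conditioning on finitely many functionals preserves one-sided Lipschitz bounds along the
directions which they span. -/
theorem ae_le_of_condExp_eq_comp (hmean : ∀ ℓ : StrongDual ℝ Ω, ∫ ω, ℓ ω ∂P = 0)
    (hk : Orthonormal ℝ fun j => ofDual P (k j)) {G : Ω → ℝ} (hG : Measurable G) {B : ℝ}
    (hGB : ∀ ω, |G ω| ≤ B) {g : (Fin m → ℝ) → ℝ} (hg : Measurable g) (hgB : ∀ x, |g x| ≤ B)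
    (hGg : P[G | MeasurableSpace.comap (fun ω j => k j ω) inferInstance] =ᵐ[P]
      fun ω => g fun j => k j ω)
    {a : Fin m → ℝ} {C : ℝ}
    (hC : ∀ᵐ ω ∂P, G (ω + embed (ofDual P (∑ i, a i • k i))) ≤ G ω + C) :
    ∀ᵐ x ∂(P.map fun ω j => k j ω), g (x + a) ≤ g x + C := by
  set X : Ω → Fin m → ℝ := fun ω j => k j ω with hXdef
  have hX : Measurable X := by fun_prop
  have hXm : Measurable[MeasurableSpace.comap X inferInstance] X := comap_measurable X
  have hle : MeasurableSpace.comap X inferInstance ≤ ‹MeasurableSpace Ω› := hX.comap_le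
  set κ : StrongDual ℝ Ω := ∑ i, a i • k i with hκdef
  have hXadd (ω : Ω) : X (ω + embed (ofDual P κ)) = X ω + a := apply_add_embed_sum_smul hk a ω
  have hbdd {f : Ω → ℝ} (hf : Measurable f) {M : ℝ} (hM : ∀ ω, |f ω| ≤ M) : Integrable f P :=
    Integrable.of_bound hf.aestronglyMeasurable M (ae_of_all _ hM)
  have hprob : IsProbabilityMeasure (P.map X) := Measure.isProbabilityMeasure_map (by fun_prop)
  have hga : Measurable fun x => g (x + a) := hg.comp (measurable_id.add_const a)
  refine ae_le_of_forall_setIntegral_le (f := fun x => g (x + a)) (g := fun x => g x + C)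
    (Integrable.of_bound hga.aestronglyMeasurable B (ae_of_all _ fun x => hgB _))
    ((Integrable.of_bound (by fun_prop) B (ae_of_all _ fun x => hgB _)).add (integrable_const C))
    fun T hT _ => ?_
  rw [setIntegral_map hT hga.aestronglyMeasurable hX.aemeasurable,
    setIntegral_map hT (by fun_prop) hX.aemeasurable, ← integral_indicator (hX hT),
    ← integral_indicator (hX hT)]
  -- `ρ` is the Cameron-Martin density, and `u` is the indicator of `X ∈ T` moved so that shifting
  -- by `κ` restores it. Since `κ` lies in the span of the `k i`, both are functions of `X` and pass
  -- through the conditional expectation.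
  let ρ : Ω → ℝ := fun ω => Real.exp (κ ω - ‖ofDual P κ‖ ^ 2 / 2)
  let u : Ω → ℝ := fun ω => T.indicator 1 (X ω - a)
  have hum : Measurable[MeasurableSpace.comap X inferInstance] u :=
    (measurable_one.indicator hT).comp (hXm.sub_const a)
  have hρm : Measurable[MeasurableSpace.comap X inferInstance] ρ := by
    have : κ = fun ω => ∑ i, a i * X ω i := by
      ext ω; simp [hκdef, hXdef]
    have h2 : Measurable fun x : Fin m → ℝ =>
      Real.exp (∑ i, a i * x i - ‖ofDual P κ‖ ^ 2 / 2) := by fun_prop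
    convert h2.comp hXm using 1
    ext ω
    simp only [ρ, this, Function.comp_apply]
  have hu1 (ω) : |u ω| ≤ 1 := by
    simp only [u, Set.indicator]
    split_ifs <;> simp
  have hρint : Integrable ρ P := integrable_exp_sub_dual hmean κ
  have hρu : Integrable (ρ * u) P :=
    hρint.mul_bdd (c := 1) (hum.mono hle le_rfl).aestronglyMeasurable (ae_of_all _ hu1)
  have hρuG : Integrable (ρ * u * G) P :=
    hρu.mul_bdd (c := B) hG.aestronglyMeasurable (ae_of_all _ hGB)
  have hind (f : Ω → ℝ) (ω : Ω) : (X ⁻¹' T).indicator f ω =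
      u (ω + embed (ofDual P κ)) * f ω := by
    have hu : u (ω + embed (ofDual P κ)) = T.indicator 1 (X ω) := by
      simp only [u]
      rw [hXadd, add_sub_cancel_right]
    rw [hu]
    by_cases hω : X ω ∈ T
    · rw [Set.indicator_of_mem (show ω ∈ X ⁻¹' T from hω), Set.indicator_of_mem hω]
      simp
    · rw [Set.indicator_of_notMem (show ω ∉ X ⁻¹' T from hω), Set.indicator_of_notMem hω]
      simp
  -- The shift is traded for `ρ`, the conditional expectation is replaced by `G`, the shift is
  -- restored to apply `hC`, and `G` is conditioned again.
  calc ∫ ω, (X ⁻¹' T).indicator (fun ω => g (X ω + a)) ω ∂P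
      = ∫ ω, u (ω + embed (ofDual P κ)) * g (X (ω + embed (ofDual P κ))) ∂P := by
        simp_rw [hind, hXadd]
    _ = ∫ ω, ρ ω * (u ω * g (X ω)) ∂P :=
        integral_comp_add_embed hmean κ (f := fun ω => u ω * g (X ω))
          ((hum.mono hle le_rfl).mul (hg.comp hX))
    _ = ∫ ω, (ρ * u * P[G | MeasurableSpace.comap X inferInstance]) ω ∂P := by
        refine integral_congr_ae ?_
        filter_upwards [hGg] with ω h1
        simp only [Pi.mul_apply, h1, mul_assoc]
        rfl
    _ = ∫ ω, (ρ * u * G) ω ∂P := by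
        rw [← integral_condExp hle (f := ρ * u * G)]
        exact integral_congr_ae (condExp_mul_of_stronglyMeasurable_left
          (hρm.mul hum).stronglyMeasurable hρuG (hbdd hG hGB)).symm
    _ = ∫ ω, u (ω + embed (ofDual P κ)) * G (ω + embed (ofDual P κ)) ∂P := by
        rw [integral_comp_add_embed hmean κ (f := fun ω => u ω * G ω)
          ((hum.mono hle le_rfl).mul hG)]
        simp only [Pi.mul_apply, mul_assoc]
        rfl
    _ ≤ ∫ ω, (X ⁻¹' T).indicator (fun ω => G ω + C) ω ∂P := by
        refine integral_mono_ae ?_ ?_ ?_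
        · refine hbdd (M := 1 * B) (by have := hum.mono hle le_rfl; fun_prop) fun ω => ?_
          rw [abs_mul]
          exact mul_le_mul (hu1 _) (hGB _) (abs_nonneg _) zero_le_one
        · exact ((hbdd hG hGB).add (integrable_const C)).indicator (hX hT)
        · filter_upwards [hC] with ω h1
          simp only [hind]
          gcongr
          simp only [u, Set.indicator]
          split_ifs <;> simp
    _ = ∫ ω, (X ⁻¹' T).indicator (fun ω => g (X ω) + C) ω ∂P := by
        have hXT : MeasurableSet[MeasurableSpace.comap X inferInstance] (X ⁻¹' T) := hXm hT
        rw [integral_indicator (hX hT), integral_indicator (hX hT),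
          integral_add (hbdd hG hGB).integrableOn (integrable_const C),
          integral_add (f := fun ω => g (X ω)) (hbdd (hg.comp hX) fun ω => hgB _).integrableOn
            (integrable_const C),
          ← setIntegral_condExp hle (hbdd hG hGB) hXT]
        congr 1
        exact integral_congr_ae (ae_restrict_of_ae hGg)

end WienerSpace

/-! ### Gradient bounds and smooth approximation of conditional expectations. -/

namespace WienerSpace

/-- If `f` is Lipschitz for the norm induced by an orthonormal family, then the corresponding
gradient is bounded by the Lipschitz constant. -/
theorem norm_sum_fderiv_smul_le {H : Type*} [NormedAddCommGroup H] [InnerProductSpace ℝ H] {m : ℕ}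
    {e : Fin m → H} (he : Orthonormal ℝ e) {f : (Fin m → ℝ) → ℝ} (hf : Differentiable ℝ f)
    {C : ℝ} (hC : 0 ≤ C) (hfC : ∀ x a, f (x + a) ≤ f x + C * ‖∑ i, a i • e i‖) (x : Fin m → ℝ) :
    ‖∑ i, fderiv ℝ f x (Pi.single i 1) • e i‖ ≤ C := by
  -- The Lipschitz bound is tested in the gradient direction `c`, where the derivative equals the
  -- squared norm of the gradient.
  set c : Fin m → ℝ := fun i => fderiv ℝ f x (Pi.single i 1) with hc
  have h1 : fderiv ℝ f x c = ‖∑ i, c i • e i‖ ^ 2 := by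
    rw [← real_inner_self_eq_norm_sq, he.inner_sum c c Finset.univ]
    conv_lhs => rw [pi_eq_sum_univ' c, map_sum]
    simp [hc]
  have h2 : fderiv ℝ f x c ≤ C * ‖∑ i, c i • e i‖ := by
    refine le_of_tendsto ((hf x).hasFDerivAt.hasLineDerivAt c).tendsto_slope_zero_right ?_
    filter_upwards [self_mem_nhdsWithin] with t (ht : 0 < t)
    have h3 := hfC x (t • c)
    have h4 : ‖∑ i, (t • c) i • e i‖ = t * ‖∑ i, c i • e i‖ := by
      simp_rw [Pi.smul_apply, smul_assoc]
      rw [← Finset.smul_sum, norm_smul, Real.norm_of_nonneg ht.le]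
    rw [h4] at h3
    rw [smul_eq_mul, inv_mul_le_iff₀ ht]
    linarith
  rw [h1, sq] at h2
  rcases (norm_nonneg (∑ i, c i • e i)).eq_or_lt with h0 | h0
  · exact h0 ▸ hC
  · exact le_of_mul_le_mul_right h2 h0

variable {Ω : Type*} [NormedAddCommGroup Ω] [NormedSpace ℝ Ω] [CompleteSpace Ω]
  [TopologicalSpace.SeparableSpace Ω] [MeasurableSpace Ω] [BorelSpace Ω]
  {P : Measure Ω} [IsGaussian P]

/-- A smooth function of orthonormal functionals is a smooth random variable, and a bound on its
gradient follows from a Lipschitz estimate. -/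
theorem exists_isSmoothWithDeriv_comp {m : ℕ} {k : Fin m → StrongDual ℝ Ω}
    (hk : Orthonormal ℝ fun j => ofDual P (k j)) {f : (Fin m → ℝ) → ℝ} (hf : f.HasTemperateGrowth)
    {C : ℝ} (hC : 0 ≤ C) (hfC : ∀ x a, f (x + a) ≤ f x + C * ‖ofDual P (∑ i, a i • k i)‖) :
    ∃ D : Ω → CameronMartin P, IsSmoothWithDeriv P (fun ω => f fun j => k j ω) D ∧
      MemLp D 2 P ∧ eLpNorm D 2 P ≤ ENNReal.ofReal C := by
  have hfd : Differentiable ℝ f := hf.1.differentiable (by simp)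
  have hcont (v : Fin m → ℝ) : Continuous fun x => fderiv ℝ f x v :=
    (hf.1.continuous_fderiv (by simp)).clm_apply continuous_const
  let D : Ω → CameronMartin P := fun ω =>
    ∑ i, fderiv ℝ f (fun j => k j ω) (Pi.single i 1) • ofDual P (k i)
  have hDC (ω) : ‖D ω‖ ≤ C := norm_sum_fderiv_smul_le hk hfd hC (fun x a => by
    have := hfC x a
    rw [map_sum] at this
    simpa only [map_smul] using this) _
  have hDm : AEStronglyMeasurable D P := by
    refine Finset.aestronglyMeasurable_fun_sum _ fun i _ => ?_
    refine AEStronglyMeasurable.smul_const ?_ _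
    exact ((hcont _).measurable.comp (by fun_prop)).aestronglyMeasurable
  refine ⟨D, ⟨m, fun j => ofDual P (k j), f, hf, ?_, ?_⟩, MemLp.of_bound hDm C (ae_of_all _ hDC),
    ?_⟩
  · filter_upwards [ae_all_iff.2 fun j => W_ofDual (P := P) (k j)] with ω hω
    simp only [hω]
  · filter_upwards [ae_all_iff.2 fun j => W_ofDual (P := P) (k j)] with ω hω
    simp only [hω, D]
  · refine (eLpNorm_le_of_ae_bound (ae_of_all _ hDC)).trans ?_
    simp

/-- The conditional expectation of a bounded function given finitely many orthonormal functionals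
is approximated by smooth random variables, with a bound on the derivative, if the function is
Lipschitz along a dense set of directions spanned by the functionals. -/
theorem exists_isSmoothWithDeriv_near_condExp (hmean : ∀ ℓ : StrongDual ℝ Ω, ∫ ω, ℓ ω ∂P = 0)
    {m : ℕ} {k : Fin m → StrongDual ℝ Ω}
    (hk : Orthonormal ℝ fun j => ofDual P (k j)) {G : Ω → ℝ} (hG : Measurable G) {B : ℝ}
    (hGB : ∀ ω, |G ω| ≤ B) {C : ℝ} (hC : 0 ≤ C)
    (hdense : Dense {a : Fin m → ℝ | ∀ᵐ ω ∂P, G (ω + embed (ofDual P (∑ i, a i • k i))) ≤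
      G ω + C * ‖ofDual P (∑ i, a i • k i)‖}) {ε : ℝ} (hε : 0 < ε) :
    ∃ (F : Ω → ℝ) (D : Ω → CameronMartin P), IsSmoothWithDeriv P F D ∧
      MemLp F 2 P ∧ MemLp D 2 P ∧
      eLpNorm (F - P[G | MeasurableSpace.comap (fun ω j => k j ω) inferInstance]) 2 P <
        ENNReal.ofReal ε ∧
      eLpNorm D 2 P ≤ ENNReal.ofReal C := by
  have hB : 0 ≤ B := (abs_nonneg _).trans (hGB 0)
  have hX : Measurable fun ω j => k j ω := by fun_prop
  obtain ⟨g₀, hg₀, hg₀X⟩ := (stronglyMeasurable_condExp (μ := P) (f := G)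
    (m := MeasurableSpace.comap (fun ω j => k j ω) inferInstance)).exists_eq_measurable_comp
  -- `g₀` is controlled only almost surely; truncation makes the bound hold everywhere, as
  -- mollification needs.
  let g : (Fin m → ℝ) → ℝ := fun x => max (-B) (min B (g₀ x))
  have hg : Measurable g := measurable_const.max (measurable_const.min hg₀.measurable)
  have hgB (x) : |g x| ≤ B :=
    abs_le.2 ⟨le_max_left _ _, max_le (by linarith) (min_le_left _ _)⟩
  have hGg : P[G | MeasurableSpace.comap (fun ω j => k j ω) inferInstance] =ᵐ[P]
      fun ω => g fun j => k j ω := by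
    have hbd := ae_bdd_abs_condExp_of_ae_bdd_abs (μ := P) (R := B) (f := G)
      (m := MeasurableSpace.comap (fun ω j => k j ω) inferInstance) (ae_of_all _ hGB)
    filter_upwards [hbd] with ω hω
    have h1 := congrFun hg₀X ω
    rw [Function.comp_apply] at h1
    have h2 := abs_le.1 hω
    change _ = max (-B) (min B (g₀ fun j => k j ω))
    rw [← h1, min_eq_right h2.2, max_eq_right h2.1]
  obtain ⟨hac, hac'⟩ := map_dual_absolutelyContinuous hmean hk
  obtain ⟨f, hft, hfB, hfC, hflim⟩ := exists_mollification hg hgB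
  have hfX (n : ℕ) : Measurable fun ω => f n fun j => k j ω :=
    (hft n).1.continuous.measurable.comp hX
  have hlim : Tendsto (fun n => eLpNorm ((fun ω => f n fun j => k j ω) -
      P[G | MeasurableSpace.comap (fun ω j => k j ω) inferInstance]) 2 P) atTop (𝓝 0) := by
    have h1 := tendsto_eLpNorm_sub_of_ae_bdd (μ := P) (f := fun n ω => f n fun j => k j ω)
      (g := fun ω => g fun j => k j ω) (B := B) (fun n => (hfX n).aestronglyMeasurable)
      (hg.comp hX).aestronglyMeasurable (fun n => ae_of_all _ fun ω => hfB n _)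
      (ae_of_all _ fun ω => hgB _) (ae_of_ae_map hX.aemeasurable (hac.ae_le hflim))
    refine h1.congr fun n => eLpNorm_congr_ae ?_
    filter_upwards [hGg] with ω hω
    simp [hω]
  have hfLip (n : ℕ) (x a : Fin m → ℝ) :
      f n (x + a) ≤ f n x + C * ‖ofDual P (∑ i, a i • k i)‖ := by
    -- For the smooth `f n` the estimate is a closed condition on `a`, so it extends from a dense
    -- set of directions to all.
    have hcl : IsClosed {a : Fin m → ℝ |
        f n (x + a) ≤ f n x + C * ‖ofDual P (∑ i, a i • k i)‖} := by
      refine isClosed_le ((hft n).1.continuous.comp (by fun_prop)) ?_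
      have : Continuous fun a : Fin m → ℝ => ‖ofDual P (∑ i, a i • k i)‖ := by
        simp_rw [map_sum, map_smul]
        fun_prop
      fun_prop
    have hsub : {a : Fin m → ℝ | ∀ᵐ ω ∂P, G (ω + embed (ofDual P (∑ i, a i • k i))) ≤
        G ω + C * ‖ofDual P (∑ i, a i • k i)‖} ⊆ {a : Fin m → ℝ |
        f n (x + a) ≤ f n x + C * ‖ofDual P (∑ i, a i • k i)‖} := fun a ha =>
      hfC a _ (hac'.ae_le (ae_le_of_condExp_eq_comp hmean hk hG hGB hg hgB hGg ha)) n x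
    exact hcl.closure_subset_iff.2 hsub (hdense a)
  obtain ⟨n, hn⟩ := ((tendsto_order.1 hlim).2 _ (ENNReal.ofReal_pos.2 hε)).exists
  obtain ⟨D, hD, hDm, hDC⟩ := exists_isSmoothWithDeriv_comp hk (hft n) hC (hfLip n)
  exact ⟨_, D, hD, MemLp.of_bound (hfX n).aestronglyMeasurable B (ae_of_all _ fun ω => hfB n _),
    hDm, hn, hDC⟩

/-- By full support, continuous functions equal almost surely are equal. Identities in `H` can thus
be lifted to functionals. -/
theorem ofDual_injective [P.IsOpenPosMeasure] : Function.Injective (ofDual P) := by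
  intro k ℓ h
  have h1 : (k : Ω → ℝ) =ᵐ[P] ℓ := (W_ofDual k).symm.trans (h ▸ W_ofDual ℓ)
  exact DFunLike.coe_injective ((k.continuous.ae_eq_iff_eq P ℓ.continuous).1 h1)

/-- A finite-dimensional space of functionals has a basis which is orthonormal in `L²`. -/
theorem exists_orthonormal_ofDual [P.IsOpenPosMeasure] (E : Submodule ℝ (StrongDual ℝ Ω))
    [FiniteDimensional ℝ E] :
    ∃ (m : ℕ) (k : Fin m → StrongDual ℝ Ω), Orthonormal ℝ (fun j => ofDual P (k j)) ∧
      (∀ j, k j ∈ E) ∧ ∀ ℓ ∈ E, ℓ = ∑ j, inner ℝ (ofDual P (k j)) (ofDual P ℓ) • k j := by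
  let V := E.map (ofDual P)
  let b := stdOrthonormalBasis ℝ V
  have hb (j) : ∃ ℓ ∈ E, ofDual P ℓ = b j := (b j).2
  choose k hkE hk using hb
  have hon : Orthonormal ℝ (fun j => ofDual P (k j)) := by
    simp_rw [hk]
    exact b.orthonormal.comp_linearIsometry V.subtypeₗᵢ
  refine ⟨_, k, hon, hkE, fun ℓ hℓ => ofDual_injective (P := P) ?_⟩
  have h1 := congrArg Subtype.val (b.sum_repr' ⟨ofDual P ℓ, Submodule.mem_map_of_mem hℓ⟩)
  rw [map_sum]
  simp_rw [map_smul, hk]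
  refine h1.symm.trans ?_
  rw [Submodule.coe_sum]
  rfl

end WienerSpace

/-! ### Separating sequences, martingale convergence and the Lipschitz criterion. -/

namespace WienerSpace

variable {Ω : Type*} [NormedAddCommGroup Ω] [NormedSpace ℝ Ω]

/-- A separable normed space has a separating sequence of functionals. -/
theorem exists_seq_dual_injective [TopologicalSpace.SeparableSpace Ω] :
    ∃ ℓ : ℕ → StrongDual ℝ Ω, Function.Injective fun ω i => ℓ i ω := by
  choose ℓ hℓ1 hℓ using fun n => exists_dual_vector'' ℝ (TopologicalSpace.denseSeq Ω n)
  refine ⟨ℓ, fun x y hxy => ?_⟩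
  by_contra hne
  have hv : 0 < ‖x - y‖ := norm_pos_iff.2 (sub_ne_zero.2 hne)
  obtain ⟨n, hn⟩ := (TopologicalSpace.denseRange_denseSeq Ω).exists_dist_lt (x - y) (half_pos hv)
  set d := TopologicalSpace.denseSeq Ω n
  have h0 : ℓ n (x - y) = 0 := by
    rw [map_sub, sub_eq_zero]
    exact congrFun hxy n
  -- `ℓ n` norms `d` and vanishes at `x - y`, so `d` is no longer than its distance to `x - y`; this
  -- contradicts its closeness to the nonzero `x - y`.
  have h1 : ‖d‖ ≤ ‖d - (x - y)‖ := by
    have h2 : ℓ n d = ‖d‖ := hℓ n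
    have h3 : ℓ n (d - (x - y)) = ‖d‖ := by rw [map_sub, h0, h2, sub_zero]
    rw [← h3]
    exact (le_abs_self _).trans ((ℓ n).le_of_opNorm_le (hℓ1 n) _ |>.trans (by rw [one_mul]))
  rw [dist_eq_norm, norm_sub_rev] at hn
  have h4 := norm_sub_norm_le (x - y) d
  rw [norm_sub_rev (x - y) d] at h4
  linarith

theorem comap_dual_le_of_mem_span {m n : ℕ} {k : Fin m → StrongDual ℝ Ω}
    {ℓ : Fin n → StrongDual ℝ Ω} (h : ∀ j, k j ∈ Submodule.span ℝ (Set.range ℓ)) :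
    MeasurableSpace.comap (fun ω j => k j ω) inferInstance ≤
      MeasurableSpace.comap (fun ω i => ℓ i ω) inferInstance := by
  rw [← measurable_iff_comap_le]
  refine @measurable_pi_lambda _ _ _ (_) _ _ fun j => ?_
  obtain ⟨c, hc⟩ := (Submodule.mem_span_range_iff_exists_fun ℝ).1 (h j)
  have h1 : Measurable fun x : Fin n → ℝ => ∑ i, c i * x i := by fun_prop
  convert h1.comp (comap_measurable fun ω i => ℓ i ω) using 1
  ext ω
  simp [← hc]

variable [CompleteSpace Ω] [TopologicalSpace.SeparableSpace Ω] [MeasurableSpace Ω] [BorelSpace Ω]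

/-- By Lusin-Souslin, a continuous injection of a Polish space into `ℝ^ℕ` is a measurable embedding,
so its coordinates generate the Borel σ-algebra. -/
theorem iSup_comap_dual_eq {ℓ : ℕ → StrongDual ℝ Ω} (hℓ : Function.Injective fun ω i => ℓ i ω) :
    ⨆ n, MeasurableSpace.comap (fun ω (i : Fin n) => ℓ i ω) inferInstance =
      ‹MeasurableSpace Ω› := by
  have := UniformSpace.secondCountable_of_separable Ω
  have hcont : Continuous fun ω i => ℓ i ω := by fun_prop
  refine le_antisymm (iSup_le fun n => Measurable.comap_le (by fun_prop)) ?_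
  conv_lhs => rw [← (hcont.measurableEmbedding hℓ).comap_eq]
  rw [← measurable_iff_comap_le]
  refine @measurable_pi_lambda _ _ _ (_) _ _ fun i => ?_
  refine Measurable.mono (ma := MeasurableSpace.comap (fun ω (j : Fin (i + 1)) => ℓ j ω)
    inferInstance) ?_ (le_iSup (fun n =>
    MeasurableSpace.comap (fun ω (i : Fin n) => ℓ i ω) inferInstance) (i + 1)) le_rfl
  exact (measurable_pi_apply (⟨i, i.lt_succ_self⟩ : Fin (i + 1))).comp
    (comap_measurable fun ω (j : Fin (i + 1)) => ℓ j ω)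

/-- The filtration generated by a sequence of functionals. -/
def dualFiltration (ℓ : ℕ → StrongDual ℝ Ω) : Filtration ℕ ‹MeasurableSpace Ω› where
  seq n := MeasurableSpace.comap (fun ω (i : Fin n) => ℓ i ω) inferInstance
  mono' n m hnm := by
    rw [← measurable_iff_comap_le]
    refine @measurable_pi_lambda _ _ _ (_) _ _ fun i => ?_
    exact (measurable_pi_apply (⟨i, i.2.trans_le hnm⟩ : Fin m)).comp
      (comap_measurable fun ω (i : Fin m) => ℓ i ω)
  le' n := Measurable.comap_le (by fun_prop)

/-- A bounded function which is Lipschitz in the directions of the rational span of a separating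
sequence of functionals is in `𝔻^{1,2}`. -/
theorem memSobolev_of_lipschitz {P : Measure Ω} [IsGaussian P] [P.IsOpenPosMeasure]
    (hmean : ∀ ℓ : StrongDual ℝ Ω, ∫ ω, ℓ ω ∂P = 0)
    {ℓ : ℕ → StrongDual ℝ Ω} (hℓ : Function.Injective fun ω i => ℓ i ω)
    {S : AddSubgroup (StrongDual ℝ Ω)} (hS : ∀ (q : ℚ) (i : ℕ), (q : ℝ) • ℓ i ∈ S)
    {G : Ω → ℝ} (hG : Measurable G) {B : ℝ} (hGB : ∀ ω, |G ω| ≤ B) {C : ℝ} (hC : 0 ≤ C)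
    (hGC : ∀ κ ∈ S, ∀ᵐ ω ∂P, G (ω + embed (ofDual P κ)) ≤ G ω + C * ‖ofDual P κ‖) :
    MemSobolev P 2 G := by
  refine memSobolev_of_bounded_deriv (MemLp.of_bound hG.aestronglyMeasurable B
    (ae_of_all _ hGB)) C fun ε hε => ?_
  have hint : Integrable G P := Integrable.of_bound hG.aestronglyMeasurable B (ae_of_all _ hGB)
  have hGm : StronglyMeasurable[⨆ n, dualFiltration ℓ n] G := by
    change StronglyMeasurable[⨆ n,
      MeasurableSpace.comap (fun ω (i : Fin n) => ℓ i ω) inferInstance] G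
    rw [iSup_comap_dual_eq hℓ]
    exact hG.stronglyMeasurable
  have hlim : Tendsto (fun n => eLpNorm (P[G | dualFiltration ℓ n] - G) 2 P) atTop (𝓝 0) :=
    tendsto_eLpNorm_sub_of_ae_bdd
      (fun n => (stronglyMeasurable_condExp.mono ((dualFiltration ℓ).le n)).aestronglyMeasurable)
      hG.aestronglyMeasurable (fun n => ae_bdd_abs_condExp_of_ae_bdd_abs (ae_of_all _ hGB))
      (ae_of_all _ hGB) (hint.tendsto_ae_condExp hGm)
  obtain ⟨n, hn⟩ := ((tendsto_order.1 hlim).2 _ (ENNReal.ofReal_pos.2 (half_pos hε))).exists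
  let E := Submodule.span ℝ (Set.range fun i : Fin n => ℓ i)
  have : FiniteDimensional ℝ E := FiniteDimensional.span_of_finite ℝ (Set.finite_range _)
  obtain ⟨m, k, hk, hkE, hEk⟩ := exists_orthonormal_ofDual (P := P) E
  have hseq : dualFiltration ℓ n = MeasurableSpace.comap (fun ω j => k j ω) inferInstance := by
    refine le_antisymm (comap_dual_le_of_mem_span fun i => ?_) (comap_dual_le_of_mem_span hkE)
    rw [hEk (ℓ i) (Submodule.subset_span ⟨i, rfl⟩)]
    exact Submodule.sum_smul_mem _ _ fun j _ => Submodule.subset_span ⟨j, rfl⟩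
  -- `T` converts coefficients along the `ℓ i` into coordinates in the orthonormal family. Being
  -- continuous and onto, it maps rational coefficients, whose combinations lie in `S`, to a dense
  -- set.
  let T : (Fin n → ℝ) → Fin m → ℝ :=
    fun c j => inner ℝ (ofDual P (k j)) (ofDual P (∑ i, c i • ℓ i))
  have hT (c : Fin n → ℝ) : ∑ j, T c j • k j = ∑ i, c i • ℓ i :=
    (hEk _ (Submodule.sum_smul_mem _ _ fun i _ => Submodule.subset_span ⟨i, rfl⟩)).symm
  have hTcont : Continuous T := by
    refine continuous_pi fun j => ?_
    simp_rw [T, map_sum, map_smul]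
    fun_prop
  have hTsurj : Function.Surjective T := fun a => by
    obtain ⟨c, hc⟩ := (Submodule.mem_span_range_iff_exists_fun ℝ).1
      (Submodule.sum_smul_mem E a fun j (_ : j ∈ Finset.univ) => hkE j)
    refine ⟨c, ?_⟩
    ext j
    simp_rw [T, hc, map_sum, map_smul]
    exact hk.inner_right_fintype a j
  have hrat : DenseRange fun (q : Fin n → ℚ) i => (q i : ℝ) :=
    DenseRange.piMap fun _ => Rat.denseRange_cast
  have hdense : Dense {a : Fin m → ℝ | ∀ᵐ ω ∂P, G (ω + embed (ofDual P (∑ i, a i • k i))) ≤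
      G ω + C * ‖ofDual P (∑ i, a i • k i)‖} := by
    refine (hTsurj.denseRange.comp hrat hTcont).mono ?_
    rintro _ ⟨q, rfl⟩
    have hmem : ∑ j, T (fun i => (q i : ℝ)) j • k j ∈ S := by
      rw [hT]
      exact AddSubgroup.sum_mem _ fun i _ => hS _ _
    exact hGC _ hmem
  obtain ⟨F, D, hFD, hF, hD, hFG, hDC⟩ :=
    exists_isSmoothWithDeriv_near_condExp hmean hk hG hGB hC hdense (half_pos hε)
  rw [← hseq] at hFG
  refine ⟨F, D, hFD, hF, hD, ?_, hDC⟩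
  have hm : AEStronglyMeasurable (P[G | dualFiltration ℓ n]) P :=
    (stronglyMeasurable_condExp.mono ((dualFiltration ℓ).le n)).aestronglyMeasurable
  calc eLpNorm (F - G) 2 P
      = eLpNorm ((F - P[G | dualFiltration ℓ n]) + (P[G | dualFiltration ℓ n] - G)) 2 P := by
        rw [sub_add_sub_cancel]
    _ ≤ _ := eLpNorm_add_le (hF.1.sub hm) (hm.sub hG.aestronglyMeasurable) one_le_two
    _ < ENNReal.ofReal (ε / 2) + ENNReal.ofReal (ε / 2) := ENNReal.add_lt_add hFG hn
    _ = ENNReal.ofReal ε := by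
        rw [← ENNReal.ofReal_add (half_pos hε).le (half_pos hε).le, add_halves]

end WienerSpace

/-! ### Localization: Lipschitz points and McShane extension. -/

namespace WienerSpace

variable {Ω : Type*} [NormedAddCommGroup Ω] [NormedSpace ℝ Ω]

/-- Countability keeps intersections and infima over directions measurable, and lets almost sure
statements hold for all directions at once. -/
theorem exists_countable_addSubgroup_smul_mem (ℓ : ℕ → StrongDual ℝ Ω) :
    ∃ S : AddSubgroup (StrongDual ℝ Ω), Countable S ∧ ∀ (q : ℚ) (i : ℕ), (q : ℝ) • ℓ i ∈ S := by
  let φ : (ℕ →₀ ℚ) →+ StrongDual ℝ Ω := Finsupp.liftAddHom fun i =>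
    (AddMonoidHom.flip (smulAddHom ℝ (StrongDual ℝ Ω)) (ℓ i)).comp (Rat.castHom ℝ).toAddMonoidHom
  refine ⟨φ.range, (Set.countable_range φ).to_subtype, fun q i => ⟨Finsupp.single i q, ?_⟩⟩
  simp [φ]

variable [MeasurableSpace Ω] {P : Measure Ω}

/-- The points at which `F` is bounded by `n` and, for increments of norm less than `1 / (n + 1)`
in `S`, satisfies a Lipschitz estimate with constant `n`. -/
def lipschitzPoints (P : Measure Ω) (S : AddSubgroup (StrongDual ℝ Ω)) (F : Ω → ℝ) (n : ℕ) :
    Set Ω :=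
  {ω | |F ω| ≤ n} ∩ ⋂ κ : S, {ω | ‖ofDual P (κ : StrongDual ℝ Ω)‖ < 1 / ((n : ℝ) + 1) →
    |F (ω + embed (ofDual P κ)) - F ω| ≤ n * ‖ofDual P (κ : StrongDual ℝ Ω)‖}

theorem lipschitzPoints_mono (S : AddSubgroup (StrongDual ℝ Ω)) (F : Ω → ℝ) :
    Monotone (lipschitzPoints P S F) := by
  intro n m hnm ω hω
  have hnm' : (n : ℝ) ≤ m := by exact_mod_cast hnm
  refine ⟨hω.1.trans hnm', Set.mem_iInter.2 fun κ hκ => ?_⟩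
  refine (Set.mem_iInter.1 hω.2 κ (hκ.trans_le ?_)).trans (by gcongr)
  exact one_div_le_one_div_of_le (by positivity) (by gcongr)

/-- Short increments use the local estimate. For long ones, `1 ≤ (n + 1) * ‖ofDual P κ‖`, so the
crude difference bound `2 * n` is absorbed; this fixes the constant. -/
theorem le_add_of_mem_lipschitzPoints {S : AddSubgroup (StrongDual ℝ Ω)} {F : Ω → ℝ} {n : ℕ}
    {ω : Ω} (hω : ω ∈ lipschitzPoints P S F n) {κ : StrongDual ℝ Ω} (hκ : κ ∈ S)
    (hωκ : ω + embed (ofDual P κ) ∈ lipschitzPoints P S F n) :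
    F ω ≤ F (ω + embed (ofDual P κ)) + 2 * n * (n + 1) * ‖ofDual P κ‖ := by
  have hn : (0 : ℝ) ≤ n := n.cast_nonneg
  rcases lt_or_ge ‖ofDual P κ‖ (1 / ((n : ℝ) + 1)) with h | h
  · have h1 := (abs_le.1 (Set.mem_iInter.1 hω.2 ⟨κ, hκ⟩ h)).1
    change -(n * ‖ofDual P κ‖) ≤ F (ω + embed (ofDual P κ)) - F ω at h1
    have h2 : n * ‖ofDual P κ‖ ≤ 2 * n * (n + 1) * ‖ofDual P κ‖ := by
      gcongr
      nlinarith
    linarith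
  · have h1 := (abs_le.1 (show |F ω| ≤ n from hω.1)).2
    have h2 := (abs_le.1 (show |F (ω + embed (ofDual P κ))| ≤ n from hωκ.1)).1
    rw [div_le_iff₀ (by positivity)] at h
    nlinarith

theorem measurableSet_lipschitzPoints [BorelSpace Ω]
    {S : AddSubgroup (StrongDual ℝ Ω)} [Countable S] {F : Ω → ℝ} (hF : Measurable F) (n : ℕ) : MeasurableSet (lipschitzPoints P S F n) := by
  refine (measurableSet_le hF.abs measurable_const).inter (MeasurableSet.iInter fun κ => ?_)
  refine (MeasurableSet.const _).imp (measurableSet_le ?_ measurable_const)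
  exact ((hF.comp (measurable_id.add_const _)).sub hF).abs

variable [CompleteSpace Ω] [TopologicalSpace.SeparableSpace Ω] [BorelSpace Ω] [IsGaussian P]

theorem embed_add (g h : CameronMartin P) : embed (g + h) = embed g + embed h := by
  refine (SeparatingDual.eq_iff_forall_dual_eq (R := ℝ)).2 fun ℓ => ?_
  rw [map_add]
  simp_rw [apply_embed_eq_inner]
  exact inner_add_left _ _ _

theorem embed_zero : embed (0 : CameronMartin P) = 0 := by
  have := embed_add (P := P) 0 0
  rwa [add_zero, left_eq_add] at this

/-- McShane extension: a bounded function which is Lipschitz on a set, along a countable group of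
directions, extends to a bounded function which is Lipschitz along these directions. -/
theorem exists_lipschitz_extension {S : AddSubgroup (StrongDual ℝ Ω)} [Countable S] {A : Set Ω}
    (hA : MeasurableSet A) {F : Ω → ℝ} (hF : Measurable F) {B : ℝ} (hB : 0 ≤ B)
    (hFB : ∀ ω ∈ A, |F ω| ≤ B) {C : ℝ} (hC : 0 ≤ C)
    (hFC : ∀ ω ∈ A, ∀ κ ∈ S, ω + embed (ofDual P κ) ∈ A →
      F ω ≤ F (ω + embed (ofDual P κ)) + C * ‖ofDual P κ‖) :
    ∃ G : Ω → ℝ, Measurable G ∧ (∀ ω, |G ω| ≤ B) ∧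
      (∀ κ ∈ S, ∀ ω, G (ω + embed (ofDual P κ)) ≤ G ω + C * ‖ofDual P κ‖) ∧
      ∀ ω ∈ A, G ω = F ω := by
  classical
  -- The value `B` off `A` dominates `F` on `A`, so points outside `A` cannot lower the infimum
  -- below `F`, and `|G| ≤ B` is kept.
  let Φ : Ω → ℝ := A.piecewise F fun _ => B
  have hΦ : Measurable Φ := hF.piecewise hA measurable_const
  have hΦA {ω} (h : ω ∈ A) : Φ ω = F ω := Set.piecewise_eq_of_mem _ _ _ h
  have hΦA' {ω} (h : ω ∉ A) : Φ ω = B := Set.piecewise_eq_of_notMem _ _ _ h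
  have hΦB (ω) : |Φ ω| ≤ B := by
    by_cases h : ω ∈ A
    · rw [hΦA h]; exact hFB ω h
    · rw [hΦA' h, abs_of_nonneg hB]
  let G : Ω → ℝ := fun ω =>
    ⨅ κ : S, Φ (ω + embed (ofDual P κ)) + C * ‖ofDual P (κ : StrongDual ℝ Ω)‖
  have hlow (ω) (κ : S) :
      -B ≤ Φ (ω + embed (ofDual P κ)) + C * ‖ofDual P (κ : StrongDual ℝ Ω)‖ := by
    have := (abs_le.1 (hΦB (ω + embed (ofDual P κ)))).1
    have : 0 ≤ C * ‖ofDual P (κ : StrongDual ℝ Ω)‖ := by positivity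
    linarith
  have hbdd (ω) : BddBelow (Set.range fun κ : S =>
      Φ (ω + embed (ofDual P κ)) + C * ‖ofDual P (κ : StrongDual ℝ Ω)‖) :=
    ⟨-B, by rintro _ ⟨κ, rfl⟩; exact hlow ω κ⟩
  have hGΦ (ω) : G ω ≤ Φ ω := by
    refine (ciInf_le (hbdd ω) 0).trans ?_
    simp only [ZeroMemClass.coe_zero, map_zero, embed_zero, norm_zero, mul_zero, add_zero, le_refl]
  refine ⟨G, ?_, fun ω => abs_le.2 ⟨le_ciInf (hlow ω), (hGΦ ω).trans (abs_le.1 (hΦB ω)).2⟩,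
    ?_, ?_⟩
  · exact Measurable.iInf fun κ => (hΦ.comp (measurable_id.add_const _)).add_const _
  · intro κ hκ ω
    rw [← sub_le_iff_le_add]
    refine le_ciInf fun τ => ?_
    -- The competitor `τ - κ`, available because `S` is a group, reaches the same point `ω + τ`.
    have h1 := ciInf_le (hbdd (ω + embed (ofDual P κ))) (τ - ⟨κ, hκ⟩)
    have h2 : ω + embed (ofDual P κ) + embed (ofDual P (τ - κ)) = ω + embed (ofDual P τ) := by
      rw [add_assoc, ← embed_add, ← map_add, add_sub_cancel]
    simp only [AddSubgroup.coe_sub, h2] at h1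
    rw [map_sub] at h1
    have h3 := mul_le_mul_of_nonneg_left
      (norm_sub_le (ofDual P (τ : StrongDual ℝ Ω)) (ofDual P κ)) hC
    change (⨅ τ : S, Φ (ω + embed (ofDual P κ) + embed (ofDual P τ)) +
      C * ‖ofDual P (τ : StrongDual ℝ Ω)‖) - _ ≤ _
    linarith
  · intro ω hω
    refine le_antisymm ((hGΦ ω).trans (hΦA hω).le) (le_ciInf fun κ => ?_)
    by_cases h : ω + embed (ofDual P κ) ∈ A
    · rw [hΦA h]
      exact hFC ω hω κ κ.2 h
    · rw [hΦA' h]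
      have := (abs_le.1 (hFB ω hω)).2
      have : 0 ≤ C * ‖ofDual P (κ : StrongDual ℝ Ω)‖ := by positivity
      linarith

theorem LocallyHDifferentiable.ae_exists_mem_lipschitzPoints
    (hmean : ∀ ℓ : StrongDual ℝ Ω, ∫ ω, ℓ ω ∂P = 0) {F : Ω → ℝ} (hF : LocallyHDifferentiable P F)
    (S : AddSubgroup (StrongDual ℝ Ω)) [Countable S] {F' : Ω → ℝ} (hFF' : F =ᵐ[P] F') :
    ∀ᵐ ω ∂P, ∃ n, ω ∈ lipschitzPoints P S F' n := by
  obtain ⟨-, q, -, hq, hdiff⟩ := hF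
  have hshift : ∀ᵐ ω ∂P, ∀ κ : S, F (ω + embed (ofDual P κ)) = F' (ω + embed (ofDual P κ)) :=
    ae_all_iff.2 fun κ => (quasiMeasurePreserving_add_embed hmean _).ae hFF'
  filter_upwards [hq, hFF', hshift] with ω hqω hω hωκ
  have hopen : IsOpen {h : CameronMartin P | ENNReal.ofReal ‖h‖ < q ω} :=
    isOpen_lt (ENNReal.continuous_ofReal.comp continuous_norm) continuous_const
  have hd : DifferentiableAt ℝ (fun h : CameronMartin P => F (ω + embed h)) 0 :=
    ((hdiff ω).differentiableOn one_ne_zero).differentiableAt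
      (hopen.mem_nhds (by simpa using hqω))
  obtain ⟨K, hK⟩ := hd.isBigO_sub.bound
  obtain ⟨r, hr, hrK⟩ := Metric.eventually_nhds_iff.1 hK
  -- `n` must dominate the local Lipschitz constant, the value of `F'`, and the inverse of the
  -- radius on which the estimate holds.
  obtain ⟨n, hn⟩ := exists_nat_gt (max (max K |F' ω|) (1 / r))
  refine ⟨n, ((le_max_right _ _).trans (le_max_left _ _)).trans hn.le,
    Set.mem_iInter.2 fun κ hκ => ?_⟩
  have hrn : 1 / ((n : ℝ) + 1) ≤ r := by
    rw [div_le_iff₀ (by positivity)]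
    have := (le_max_right _ _).trans hn.le
    rw [div_le_iff₀ hr] at this
    nlinarith
  have h1 := hrK (y := ofDual P κ) (by rw [dist_zero_right]; exact hκ.trans_le hrn)
  rw [embed_zero, add_zero, sub_zero, Real.norm_eq_abs, hωκ κ, hω] at h1
  refine h1.trans ?_
  gcongr
  exact ((le_max_left _ _).trans (le_max_left _ _)).trans hn.le

end WienerSpace

/-- On an abstract Wiener space (a separable Banach space `Ω` with a centred Gaussian measure `P`
of full support), every locally `H`-differentiable random variable is in `𝔻^{1,2}_loc`. -/
theorem proposition2p2 {Ω : Type*} [NormedAddCommGroup Ω] [NormedSpace ℝ Ω] [CompleteSpace Ω]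
    [TopologicalSpace.SeparableSpace Ω] [MeasurableSpace Ω] [BorelSpace Ω]
    (P : Measure Ω) [IsGaussian P] [P.IsOpenPosMeasure]
    (hmean : ∀ ℓ : StrongDual ℝ Ω, ∫ ω, ℓ ω ∂P = 0) :
    {F : Ω → ℝ | WienerSpace.LocallyHDifferentiable P F} ⊆
      {F : Ω → ℝ | WienerSpace.MemSobolevLoc P 2 F} := by
  intro F hF
  obtain ⟨F', hF', hFF'⟩ := hF.1.aemeasurable
  obtain ⟨ℓ, hℓ⟩ := WienerSpace.exists_seq_dual_injective (Ω := Ω)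
  obtain ⟨S, hScount, hS⟩ := WienerSpace.exists_countable_addSubgroup_smul_mem ℓ
  have hae := hF.ae_exists_mem_lipschitzPoints hmean S hFF'
  have hmeas := WienerSpace.measurableSet_lipschitzPoints (P := P) (S := S) hF'
  have hmono := WienerSpace.lipschitzPoints_mono (P := P) S F'
  set A := WienerSpace.lipschitzPoints P S F'
  choose G hGm hGB hGC hGA using fun n : ℕ => WienerSpace.exists_lipschitz_extension (P := P)
    (S := S) (hmeas n) hF' n.cast_nonneg (fun ω hω => hω.1)
    (C := 2 * n * (n + 1)) (by positivity)
    fun ω hω κ hκ hωκ => WienerSpace.le_add_of_mem_lipschitzPoints hω hκ hωκ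
  -- The null set missed by all `A m` is added to every set, so that the union is exactly `Ω`.
  refine ⟨fun n => A n ∪ (⋃ m, A m)ᶜ, G, fun n => ?_, fun n => ?_, fun n m hnm => ?_, ?_,
    fun n => ?_⟩
  · exact ((hmeas n).union (MeasurableSet.iUnion hmeas).compl).nullMeasurableSet
  · exact WienerSpace.memSobolev_of_lipschitz hmean hℓ hS (hGm n) (hGB n) (by positivity)
      fun κ hκ => ae_of_all _ (hGC n κ hκ)
  · exact Set.union_subset_union_left _ (hmono hnm)
  · rw [← Set.iUnion_union, Set.union_compl_self]
  · filter_upwards [hae, hFF'] with ω hω hFω hmem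
    rcases hmem with h | h
    · rw [hGA n ω h, hFω]
    · exact absurd (Set.mem_iUnion.2 hω) h
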